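/- Let $(\Omega,\Sigma,\mathbb P)$ be a nonatomic probability space. An Orlicz function is a convex, increasing function $[0,\infty)\to[0,\infty)$ vanishing at $0$. Let $\Phi$ be an Orlicz function with $\Phi(t)>0$ for all $t>0$ and $\lim_{t\to\infty}\Phi(t)/t=\infty$, and let $\Psi$ be its conjugate Orlicz function, $\Psi(s)=\sup\{ts-\Phi(t):t\ge 0\}$ for $s\ge 0$. Let $L^\Phi$ be the space of all real random variables $X$ on $\Omega$ (modulo a.s. equality) with $$\|X\|_\Phi:=\inf\{\lambda>0:\mathbb E[\Phi(|X|/\lambda)]\le 1\}<\infty,$$ and define $L^\Psi$ in the same way from $\Psi$. Let $\sigma(L^\Phi,L^\Psi)$ be the weak topology on $L^\Phi$ induced by the pairing $(X,Y)\mapsto\mathbb E[XY]$, $Y\in L^\Psi$. For $\mathcal C\subset L^\Phi$, the order closure $\overline{\mathcal C}^{o}$ is the set of all $X\in L^\Phi$ for which there are a sequence $(X_n)$ in $\mathcal C$ and some $B\in L^\Phi$ such that $X_n\to X$ a.s. and $|X_n|\le B$ a.s. for all $n$. Then $\overline{\mathcal C}^{o}=\overline{\mathcal C}^{\sigma(L^\Phi,L^\Psi)}$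 for every convex set $\mathcal C\subset L^\Phi$ if and only if $\Phi$ satisfies the $\Delta_2$-condition, i.e. there exist $t_0\in(0,\infty)$ and $k\in\mathbb R$ such that $\Phi(2t)<k\,\Phi(t)$ for all $t\ge t_0$. -/

import Mathlib

open MeasureTheory Filter Topology
open scoped NNReal ENNReal

/-- An Orlicz function: a convex, increasing function `[0, ∞) → [0, ∞)` vanishing at `0`. -/
structure OrliczFunction where
  toFun : ℝ≥0 → ℝ≥0
  convexOn : ConvexOn ℝ≥0 Set.univ toFun
  monotone : Monotone toFun
  map_zero : toFun 0 = 0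

namespace OrliczFunction

instance : CoeFun OrliczFunction (fun _ => ℝ≥0 → ℝ≥0) := ⟨toFun⟩

/-- `Ψ` is the conjugate of `Φ`: for every `s ≥ 0`, the real supremum
`sup {t * s - Φ t : t ≥ 0}` is finite and equal to `Ψ s`. -/
def IsConjugate (Φ Ψ : OrliczFunction) : Prop :=
  ∀ s : ℝ≥0, IsLUB (Set.range fun t : ℝ≥0 => (t : ℝ) * (s : ℝ) - (Φ t : ℝ)) (Ψ s : ℝ)

/-- The `Δ₂`-condition (for large arguments). -/
def DeltaTwo (Φ : OrliczFunction) : Prop :=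
  ∃ t₀ : ℝ≥0, 0 < t₀ ∧ ∃ k : ℝ, ∀ t : ℝ≥0, t₀ ≤ t → (Φ (2 * t) : ℝ) < k * (Φ t : ℝ)

end OrliczFunction

/-- A nonatomic measure: every measurable set of positive measure contains a measurable
subset of strictly smaller positive measure. -/
def IsNonatomic {Ω : Type*} [MeasurableSpace Ω] (μ : Measure Ω) : Prop :=
  ∀ s, MeasurableSet s → 0 < μ s → ∃ t ⊆ s, MeasurableSet t ∧ 0 < μ t ∧ μ t < μ s

section Orlicz

variable {Ω : Type*} [MeasurableSpace Ω]

/-- The Luxemburg norm `inf {l > 0 : E[Φ(|X| / l)] ≤ 1}`, with the infimum of the empty set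
equal to `∞`. -/
noncomputable def luxemburgNorm (Φ : OrliczFunction) (μ : Measure Ω) (X : Ω →ₘ[μ] ℝ) : ℝ≥0∞ :=
  ⨅ (l : ℝ≥0) (_ : 0 < l) (_ : ∫⁻ ω, (Φ (‖X ω‖₊ / l) : ℝ≥0∞) ∂μ ≤ 1), (l : ℝ≥0∞)

theorem luxemburgNorm_lt_top_iff (Φ : OrliczFunction) (μ : Measure Ω) (X : Ω →ₘ[μ] ℝ) :
    luxemburgNorm Φ μ X < ⊤ ↔
      ∃ l : ℝ≥0, 0 < l ∧ ∫⁻ ω, (Φ (‖X ω‖₊ / l) : ℝ≥0∞) ∂μ ≤ 1 := by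
  simp [luxemburgNorm, iInf_lt_iff]

theorem aemeasurable_orlicz (Φ : OrliczFunction) {μ : Measure Ω} (X : Ω →ₘ[μ] ℝ) (l : ℝ≥0) :
    AEMeasurable (fun ω => (Φ (‖X ω‖₊ / l) : ℝ≥0∞)) μ :=
  measurable_coe_nnreal_ennreal.comp_aemeasurable
    (Φ.monotone.measurable.comp_aemeasurable (X.aemeasurable.nnnorm.div_const l))

/-- The Orlicz space `L^Φ`: all real random variables, modulo almost sure equality, of finite
Luxemburg norm. -/
noncomputable def orliczSpace (Φ : OrliczFunction) (μ : Measure Ω) :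
    Submodule ℝ (Ω →ₘ[μ] ℝ) where
  carrier := {X | luxemburgNorm Φ μ X < ⊤}
  zero_mem' := by
    rw [Set.mem_ofPred_eq, luxemburgNorm_lt_top_iff]
    refine ⟨1, one_pos, ?_⟩
    have h : (fun ω => (Φ (‖(0 : Ω →ₘ[μ] ℝ) ω‖₊ / 1) : ℝ≥0∞)) =ᵐ[μ] fun _ => 0 := by
      filter_upwards [AEEqFun.coeFn_zero (μ := μ) (β := ℝ)] with ω hω
      simp [hω, Φ.map_zero]
    rw [lintegral_congr_ae h]
    simp
  add_mem' := by
    intro X Y hX hY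
    rw [Set.mem_ofPred_eq, luxemburgNorm_lt_top_iff] at hX hY ⊢
    obtain ⟨a, ha, hXa⟩ := hX
    obtain ⟨b, hb, hYb⟩ := hY
    have hab : 0 < a + b := add_pos ha hb
    refine ⟨a + b, hab, ?_⟩
    have hsum : a / (a + b) + b / (a + b) = 1 := by
      rw [← add_div, div_self hab.ne']
    have hle : ∀ᵐ ω ∂μ, (Φ (‖(X + Y) ω‖₊ / (a + b)) : ℝ≥0∞) ≤
        ((a / (a + b) : ℝ≥0) : ℝ≥0∞) * (Φ (‖X ω‖₊ / a) : ℝ≥0∞)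
          + ((b / (a + b) : ℝ≥0) : ℝ≥0∞) * (Φ (‖Y ω‖₊ / b) : ℝ≥0∞) := by
      filter_upwards [AEEqFun.coeFn_add X Y] with ω hω
      rw [hω, Pi.add_apply]
      have h1 : ‖X ω + Y ω‖₊ / (a + b) ≤
          (a / (a + b)) • (‖X ω‖₊ / a) + (b / (a + b)) • (‖Y ω‖₊ / b) := by
        have e : (a / (a + b)) • (‖X ω‖₊ / a) + (b / (a + b)) • (‖Y ω‖₊ / b)
            = (‖X ω‖₊ + ‖Y ω‖₊) / (a + b) := by
          simp only [smul_eq_mul]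
          field_simp
        rw [e]
        gcongr
        exact nnnorm_add_le _ _
      have h2 := (Φ.monotone h1).trans
        (Φ.convexOn.2 (Set.mem_univ _) (Set.mem_univ _) zero_le zero_le hsum)
      simp only [smul_eq_mul] at h2
      exact_mod_cast h2
    calc _ ≤ _ := lintegral_mono_ae hle
      _ = ((a / (a + b) : ℝ≥0) : ℝ≥0∞) * ∫⁻ ω, (Φ (‖X ω‖₊ / a) : ℝ≥0∞) ∂μ
          + ((b / (a + b) : ℝ≥0) : ℝ≥0∞) * ∫⁻ ω, (Φ (‖Y ω‖₊ / b) : ℝ≥0∞) ∂μ := by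
        rw [lintegral_add_left' ((aemeasurable_orlicz Φ X a).const_mul _),
          lintegral_const_mul'' _ (aemeasurable_orlicz Φ X a),
          lintegral_const_mul'' _ (aemeasurable_orlicz Φ Y b)]
      _ ≤ ((a / (a + b) : ℝ≥0) : ℝ≥0∞) * 1 + ((b / (a + b) : ℝ≥0) : ℝ≥0∞) * 1 := by
        gcongr
      _ = 1 := by
        rw [mul_one, mul_one]
        exact_mod_cast hsum
  smul_mem' := by
    intro c X hX
    rw [Set.mem_ofPred_eq, luxemburgNorm_lt_top_iff] at hX ⊢
    obtain ⟨a, ha, hXa⟩ := hX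
    have hc : 0 < ‖c‖₊ + 1 := by positivity
    refine ⟨(‖c‖₊ + 1) * a, mul_pos hc ha, le_trans (lintegral_mono_ae ?_) hXa⟩
    filter_upwards [AEEqFun.coeFn_smul c X] with ω hω
    rw [hω, Pi.smul_apply, smul_eq_mul, nnnorm_mul, ENNReal.coe_le_coe]
    apply Φ.monotone
    rw [mul_div_mul_comm]
    exact mul_le_of_le_one_left' ((div_le_one hc).2 (by simp))

theorem mem_orliczSpace_iff (Φ : OrliczFunction) (μ : Measure Ω) (X : Ω →ₘ[μ] ℝ) :
    X ∈ orliczSpace Φ μ ↔ luxemburgNorm Φ μ X < ⊤ := Iff.rfl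

/-- Young's inequality makes `X * Y` integrable for `X ∈ L^Φ` and `Y ∈ L^Ψ`. -/
theorem integrable_orlicz_mul {Φ Ψ : OrliczFunction} (h : Φ.IsConjugate Ψ) {μ : Measure Ω}
    (X : orliczSpace Φ μ) (Y : orliczSpace Ψ μ) :
    Integrable (fun ω => (X : Ω →ₘ[μ] ℝ) ω * (Y : Ω →ₘ[μ] ℝ) ω) μ := by
  obtain ⟨X, hX⟩ := X
  obtain ⟨Y, hY⟩ := Y
  rw [mem_orliczSpace_iff, luxemburgNorm_lt_top_iff] at hX hY
  obtain ⟨a, ha, hXa⟩ := hX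
  obtain ⟨b, hb, hYb⟩ := hY
  refine ⟨X.aestronglyMeasurable.mul Y.aestronglyMeasurable, ?_⟩
  have young : ∀ t s : ℝ≥0, t * s ≤ Φ t + Ψ s := by
    intro t s
    have h1 : (t : ℝ) * (s : ℝ) - (Φ t : ℝ) ≤ Ψ s := (h s).1 ⟨t, rfl⟩
    rw [← NNReal.coe_le_coe]
    push_cast
    linarith
  have hle : ∀ ω, ‖X ω * Y ω‖ₑ ≤ ((a * b : ℝ≥0) : ℝ≥0∞) *
      ((Φ (‖X ω‖₊ / a) : ℝ≥0∞) + (Ψ (‖Y ω‖₊ / b) : ℝ≥0∞)) := by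
    intro ω
    have h1 : ‖X ω * Y ω‖₊ = (a * b) * ((‖X ω‖₊ / a) * (‖Y ω‖₊ / b)) := by
      rw [nnnorm_mul]
      field_simp
    have h2 : ‖X ω * Y ω‖₊ ≤ (a * b) * (Φ (‖X ω‖₊ / a) + Ψ (‖Y ω‖₊ / b)) := by
      rw [h1]
      gcongr
      exact young _ _
    rw [enorm_eq_nnnorm]
    exact_mod_cast h2
  calc ∫⁻ ω, ‖X ω * Y ω‖ₑ ∂μ ≤ _ := lintegral_mono hle
    _ = ((a * b : ℝ≥0) : ℝ≥0∞) * (∫⁻ ω, (Φ (‖X ω‖₊ / a) : ℝ≥0∞) ∂μ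
          + ∫⁻ ω, (Ψ (‖Y ω‖₊ / b) : ℝ≥0∞) ∂μ) := by
      rw [lintegral_const_mul' _ _ ENNReal.coe_ne_top,
        lintegral_add_left' (aemeasurable_orlicz Φ X a)]
    _ ≤ ((a * b : ℝ≥0) : ℝ≥0∞) * (1 + 1) := by gcongr
    _ < ⊤ := ENNReal.mul_lt_top ENNReal.coe_lt_top (by norm_num)

/-- The duality pairing `(X, Y) ↦ E[X * Y]` on `L^Φ × L^Ψ`. -/
noncomputable def orliczPairing {Φ Ψ : OrliczFunction} (h : Φ.IsConjugate Ψ) (μ : Measure Ω) :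
    orliczSpace Φ μ →ₗ[ℝ] orliczSpace Ψ μ →ₗ[ℝ] ℝ :=
  LinearMap.mk₂ ℝ (fun X Y => ∫ ω, (X : Ω →ₘ[μ] ℝ) ω * (Y : Ω →ₘ[μ] ℝ) ω ∂μ)
    (by
      intro X X' Y
      rw [← integral_add (integrable_orlicz_mul h X Y) (integrable_orlicz_mul h X' Y)]
      apply integral_congr_ae
      filter_upwards [AEEqFun.coeFn_add (X : Ω →ₘ[μ] ℝ) X'] with ω hω
      simp [hω, add_mul])
    (by
      intro c X Y
      rw [smul_eq_mul, ← integral_const_mul]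
      apply integral_congr_ae
      filter_upwards [AEEqFun.coeFn_smul c (X : Ω →ₘ[μ] ℝ)] with ω hω
      simp [hω, mul_assoc])
    (by
      intro X Y Y'
      rw [← integral_add (integrable_orlicz_mul h X Y) (integrable_orlicz_mul h X Y')]
      apply integral_congr_ae
      filter_upwards [AEEqFun.coeFn_add (Y : Ω →ₘ[μ] ℝ) Y'] with ω hω
      simp [hω, mul_add])
    (by
      intro c X Y
      rw [smul_eq_mul, ← integral_const_mul]
      apply integral_congr_ae
      filter_upwards [AEEqFun.coeFn_smul c (Y : Ω →ₘ[μ] ℝ)] with ω hω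
      simp [hω, mul_left_comm])

/-- The closure of `C ⊆ L^Φ` in the weak topology `σ(L^Φ, L^Ψ)`. -/
def weakClosure {Φ Ψ : OrliczFunction} (h : Φ.IsConjugate Ψ) {μ : Measure Ω}
    (C : Set (orliczSpace Φ μ)) : Set (orliczSpace Φ μ) :=
  @closure (orliczSpace Φ μ) (WeakBilin.instTopologicalSpace (orliczPairing h μ)) C

/-- Order convergence of a sequence in `L^Φ`: almost sure convergence together with order
boundedness in `L^Φ`. -/
def OrderConverges {Φ : OrliczFunction} {μ : Measure Ω} (X : ℕ → orliczSpace Φ μ)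
    (Z : orliczSpace Φ μ) : Prop :=
  (∀ᵐ ω ∂μ, Tendsto (fun n => (X n : Ω →ₘ[μ] ℝ) ω) atTop (𝓝 ((Z : Ω →ₘ[μ] ℝ) ω))) ∧
    ∃ B : orliczSpace Φ μ, ∀ n, ∀ᵐ ω ∂μ, |(X n : Ω →ₘ[μ] ℝ) ω| ≤ (B : Ω →ₘ[μ] ℝ) ω

/-- The order closure of `C ⊆ L^Φ`: all limits of order convergent sequences in `C`. -/
def orderClosure {Φ : OrliczFunction} {μ : Measure Ω} (C : Set (orliczSpace Φ μ)) :
    Set (orliczSpace Φ μ) :=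
  {Z | ∃ X : ℕ → orliczSpace Φ μ, (∀ n, X n ∈ C) ∧ OrderConverges X Z}

end Orlicz

/-! Order convergence implies convergence of every pairing with `Y` in `L^Ψ`, by dominated
convergence, so the order closure always lies in the weak closure. The question is the converse
inclusion for convex sets.

Under Δ₂, all multiples of an element of `L^Φ` have finite modular. Hence a functional bounded on
the modular unit ball is continuous along dominated sequences, and Radon–Nikodym together with a
duality estimate represents it by some `Y` in `L^Ψ` (`exists_eq_orliczPairing`). If `X` had no
points of `C` near it in the modular sense, Hahn–Banach would give such a functional strictly
separating `X` from `C`, so `X` would not be in the weak closure (`exists_sub_mem_modularBall`).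
Fast modular approximation then gives order convergence, as in the Riesz–Fischer argument
(`mem_orderClosure_of_forall_modularBall`).

Without Δ₂ there is `X ≥ 0` with `E[Φ(X)] < ∞ = E[Φ(2X)]`. Let `C` consist of all `Z ≥ a + b X 1_{X
≥ m}` with `a b ≥ 1`. Each constant `a > 0` is an order limit of points `a + a⁻¹ X 1_{X ≥ m}` of
`C`, and the constants tend to `0`; two limits thus reach `0`, which lies in the weak closure. One
limit does not: an order bound keeps `b` bounded, because large multiples of the tails of `X` have
infinite modular, and so keeps `a` away from `0`. -/

namespace OrliczFunction

/-! ### Growth of Orlicz functions -/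

variable (Φ : OrliczFunction)

theorem map_mul_le {c : ℝ≥0} (hc : c ≤ 1) (t : ℝ≥0) : Φ (c * t) ≤ c * Φ t := by
  have h := Φ.convexOn.2 (Set.mem_univ t) (Set.mem_univ 0) (zero_le : 0 ≤ c)
    (zero_le : 0 ≤ 1 - c) (add_tsub_cancel_of_le hc)
  simpa [Φ.map_zero] using h

theorem map_le_mul_map_one {t : ℝ≥0} (ht : t ≤ 1) : Φ t ≤ t * Φ 1 := by
  simpa using Φ.map_mul_le ht 1

theorem mul_map_le {c : ℝ≥0} (hc : 1 ≤ c) (t : ℝ≥0) : c * Φ t ≤ Φ (c * t) := by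
  have hc0 : c ≠ 0 := (zero_lt_one.trans_le hc).ne'
  have h := Φ.map_mul_le (inv_le_one_of_one_le₀ hc) (c * t)
  rw [inv_mul_cancel_left₀ hc0] at h
  calc c * Φ t ≤ c * (c⁻¹ * Φ (c * t)) := by gcongr
    _ = Φ (c * t) := mul_inv_cancel_left₀ hc0 _

theorem measurable : Measurable Φ := Φ.monotone.measurable

theorem tendsto_zero : Tendsto Φ (𝓝 0) (𝓝 0) := by
  have h : Tendsto (fun t : ℝ≥0 => t * Φ 1) (𝓝 0) (𝓝 0) := by
    have : Continuous fun t : ℝ≥0 => t * Φ 1 := by fun_prop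
    simpa using this.tendsto 0
  refine tendsto_of_tendsto_of_tendsto_of_le_of_le' tendsto_const_nhds h
    (Eventually.of_forall fun _ => zero_le) ?_
  filter_upwards [Iic_mem_nhds (zero_lt_one : (0 : ℝ≥0) < 1)] with t ht
  exact Φ.map_le_mul_map_one ht

variable {Φ}

theorem tendsto_atTop (hΦ : ∀ t : ℝ≥0, 0 < t → 0 < Φ t) : Tendsto Φ atTop atTop := by
  have h : Tendsto (fun t : ℝ≥0 => t * Φ 1) atTop atTop :=
    tendsto_id.atTop_mul_const (hΦ 1 one_pos)
  refine tendsto_atTop_mono' _ ?_ h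
  filter_upwards [eventually_ge_atTop 1] with t ht
  simpa using Φ.mul_map_le ht 1

/-- The additive constant absorbs the range `t ≤ t₀`; the resulting bound holds for all `t` and can
be integrated against a finite measure. -/
theorem DeltaTwo.exists_two_mul_le (h : Φ.DeltaTwo) :
    ∃ a b : ℝ≥0, ∀ t, Φ (2 * t) ≤ a * Φ t + b := by
  obtain ⟨t₀, -, k, hk⟩ := h
  refine ⟨k.toNNReal, Φ (2 * t₀), fun t => ?_⟩
  rcases le_total t₀ t with ht | ht
  · refine le_add_right ?_
    rw [← NNReal.coe_le_coe]
    push_cast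
    exact (hk t ht).le.trans (by gcongr; exact Real.le_coe_toNNReal k)
  · exact le_add_left (Φ.monotone (by gcongr))

theorem DeltaTwo.exists_mul_le (h : Φ.DeltaTwo) (K : ℝ≥0) :
    ∃ a b : ℝ≥0, ∀ t, Φ (K * t) ≤ a * Φ t + b := by
  obtain ⟨a, b, hab⟩ := h.exists_two_mul_le
  have key : ∀ n : ℕ, ∃ a b : ℝ≥0, ∀ t, Φ (2 ^ n * t) ≤ a * Φ t + b := by
    intro n
    induction n with
    | zero => exact ⟨1, 0, fun t => by simp⟩
    | succ n ih =>
      obtain ⟨a', b', h'⟩ := ih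
      refine ⟨a * a', a * b' + b, fun t => ?_⟩
      calc Φ (2 ^ (n + 1) * t) = Φ (2 * (2 ^ n * t)) := by congr 1; ring
        _ ≤ a * Φ (2 ^ n * t) + b := hab _
        _ ≤ a * (a' * Φ t + b') + b := by gcongr; exact h' t
        _ = _ := by ring
  obtain ⟨n, hn⟩ := pow_unbounded_of_one_lt K (one_lt_two : (1 : ℝ≥0) < 2)
  obtain ⟨a', b', h'⟩ := key n
  exact ⟨a', b', fun t => (Φ.monotone (by gcongr)).trans (h' t)⟩

end OrliczFunction

/-! ### The modular and membership in the Orlicz space -/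

section Modular

variable {Ω : Type*} [MeasurableSpace Ω]

/-- The modular `E[Φ(|X|)]`. -/
noncomputable def orliczModular (Φ : OrliczFunction) (μ : Measure Ω) (X : Ω → ℝ) : ℝ≥0∞ :=
  ∫⁻ ω, (Φ ‖X ω‖₊ : ℝ≥0∞) ∂μ

variable {Φ : OrliczFunction} {μ : Measure Ω}

theorem orliczModular_congr {X Y : Ω → ℝ} (h : X =ᵐ[μ] Y) :
    orliczModular Φ μ X = orliczModular Φ μ Y :=
  lintegral_congr_ae (h.mono fun ω hω => by simp only [hω])

theorem orliczModular_mono {X Y : Ω → ℝ} (h : ∀ᵐ ω ∂μ, |X ω| ≤ |Y ω|) :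
    orliczModular Φ μ X ≤ orliczModular Φ μ Y :=
  lintegral_mono_ae (h.mono fun ω hω => ENNReal.coe_le_coe.2 (Φ.monotone (by
    rw [← NNReal.coe_le_coe]; simpa using hω)))

theorem aemeasurable_orliczModular {X : Ω → ℝ} (hX : AEMeasurable X μ) :
    AEMeasurable (fun ω => (Φ ‖X ω‖₊ : ℝ≥0∞)) μ :=
  measurable_coe_nnreal_ennreal.comp_aemeasurable (Φ.measurable.comp_aemeasurable hX.nnnorm)

theorem orliczModular_mul_le {c : ℝ} (hc0 : 0 ≤ c) (hc : c ≤ 1) (X : Ω → ℝ) :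
    orliczModular Φ μ (fun ω => c * X ω) ≤ ENNReal.ofReal c * orliczModular Φ μ X := by
  lift c to ℝ≥0 using hc0
  rw [ENNReal.ofReal_coe_nnreal, orliczModular, orliczModular,
    ← lintegral_const_mul' _ _ ENNReal.coe_ne_top]
  refine lintegral_mono fun ω => ?_
  rw [nnnorm_mul, NNReal.nnnorm_eq]
  rw [← ENNReal.coe_mul, ENNReal.coe_le_coe]
  exact Φ.map_mul_le (by exact_mod_cast hc) _

/-- Finiteness replaces the bound `1`: if the modular is `D`, convexity and `Φ 0 = 0` bring it below
`1` after scaling by `1 / (D + 1)`. -/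
theorem mem_orliczSpace_of_modular {X : Ω →ₘ[μ] ℝ} {c : ℝ} (hc : 0 < c)
    (h : orliczModular Φ μ (fun ω => c * X ω) < ⊤) : X ∈ orliczSpace Φ μ := by
  rw [mem_orliczSpace_iff, luxemburgNorm_lt_top_iff]
  set D := (orliczModular Φ μ (fun ω => c * X ω)).toReal
  have hD : 0 ≤ D := ENNReal.toReal_nonneg
  have hD1 : 0 < D + 1 := by linarith
  refine ⟨((D + 1) / c).toNNReal, by simp only [Real.toNNReal_pos]; positivity, ?_⟩
  have h1 := orliczModular_mul_le (Φ := Φ) (μ := μ) (c := (D + 1)⁻¹) (by positivity)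
    (inv_le_one_of_one_le₀ (by linarith)) (fun ω => c * X ω)
  have h2 : ENNReal.ofReal (D + 1)⁻¹ * orliczModular Φ μ (fun ω => c * X ω) ≤ 1 := by
    rw [← ENNReal.ofReal_toReal h.ne, ← ENNReal.ofReal_mul (by positivity)]
    refine ENNReal.ofReal_le_one.2 ?_
    rw [inv_mul_le_iff₀ hD1]
    change D ≤ _
    linarith
  refine le_trans (le_of_eq ?_) (h1.trans h2)
  refine lintegral_congr fun ω => ?_
  congr 2
  rw [← NNReal.coe_inj]
  push_cast
  rw [Real.coe_toNNReal _ (by positivity), Real.norm_eq_abs, Real.norm_eq_abs, abs_mul, abs_mul,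
    abs_of_pos (show 0 < (D + 1)⁻¹ by positivity), abs_of_pos hc]
  field_simp

theorem exists_modular_le_one {X : Ω →ₘ[μ] ℝ} (hX : X ∈ orliczSpace Φ μ) :
    ∃ c : ℝ, 0 < c ∧ orliczModular Φ μ (fun ω => c * X ω) ≤ 1 := by
  rw [mem_orliczSpace_iff, luxemburgNorm_lt_top_iff] at hX
  obtain ⟨l, hl, h⟩ := hX
  refine ⟨(l : ℝ)⁻¹, by positivity, le_trans (le_of_eq ?_) h⟩
  refine lintegral_congr fun ω => ?_
  congr 2
  rw [← NNReal.coe_inj]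
  push_cast
  rw [norm_mul, norm_inv, NNReal.norm_eq, div_eq_inv_mul]

theorem mem_orliczSpace_of_le {X Y : Ω →ₘ[μ] ℝ} (hY : Y ∈ orliczSpace Φ μ)
    (h : ∀ᵐ ω ∂μ, |X ω| ≤ |Y ω|) : X ∈ orliczSpace Φ μ := by
  obtain ⟨c, hc, hm⟩ := exists_modular_le_one hY
  refine mem_orliczSpace_of_modular hc ((orliczModular_mono ?_).trans_lt
    (hm.trans_lt ENNReal.one_lt_top))
  filter_upwards [h] with ω hω
  rw [abs_mul, abs_mul]
  gcongr

theorem orliczModular_le_of_bound [IsProbabilityMeasure μ] {X : Ω → ℝ} {C : ℝ≥0}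
    (h : ∀ᵐ ω ∂μ, |X ω| ≤ C) : orliczModular Φ μ X ≤ Φ C := by
  calc orliczModular Φ μ X ≤ orliczModular Φ μ (fun _ => (C : ℝ)) :=
        orliczModular_mono (by simpa using h)
    _ = Φ C := by simp [orliczModular]

theorem mem_orliczSpace_of_bound [IsProbabilityMeasure μ] {X : Ω →ₘ[μ] ℝ} {C : ℝ}
    (h : ∀ᵐ ω ∂μ, |X ω| ≤ C) : X ∈ orliczSpace Φ μ := by
  refine mem_orliczSpace_of_modular one_pos
    ((orliczModular_le_of_bound (C := C.toNNReal) ?_).trans_lt ENNReal.coe_lt_top)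
  filter_upwards [h] with ω hω
  rw [one_mul]
  exact hω.trans (Real.le_coe_toNNReal C)

/-- Dominated convergence, with continuity of `Φ` at `0`. General filters are allowed because
countable additivity needs convergence along finite sets as well as along sequences. -/
theorem tendsto_orliczModular {ι : Type*} {l : Filter ι} [l.IsCountablyGenerated]
    {X : ι → Ω → ℝ} {B : Ω → ℝ} (hX : ∀ i, AEMeasurable (X i) μ)
    (hB : orliczModular Φ μ B ≠ ⊤) (h : ∀ i, ∀ᵐ ω ∂μ, |X i ω| ≤ |B ω|)
    (hlim : ∀ᵐ ω ∂μ, Tendsto (fun i => X i ω) l (𝓝 0)) :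
    Tendsto (fun i => orliczModular Φ μ (X i)) l (𝓝 0) := by
  have := tendsto_lintegral_filter_of_dominated_convergence' (μ := μ) (l := l)
    (F := fun i ω => (Φ ‖X i ω‖₊ : ℝ≥0∞)) (f := fun _ => 0) (fun ω => (Φ ‖B ω‖₊ : ℝ≥0∞))
    (Eventually.of_forall fun i => aemeasurable_orliczModular (hX i))
    (Eventually.of_forall fun i => (h i).mono fun ω hω => ENNReal.coe_le_coe.2 (Φ.monotone (by
      rw [← NNReal.coe_le_coe]; simpa using hω))) hB ?_
  · simpa [orliczModular] using this
  · filter_upwards [hlim] with ω hω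
    have h1 : Tendsto (fun i => ‖X i ω‖₊) l (𝓝 0) := by simpa using hω.nnnorm
    exact ENNReal.tendsto_coe.2 (Φ.tendsto_zero.comp h1)

/-- The only form in which Δ₂ enters the sufficiency half. -/
theorem OrliczFunction.DeltaTwo.modular_lt_top [IsFiniteMeasure μ] (h : Φ.DeltaTwo)
    {X : Ω →ₘ[μ] ℝ} (hX : X ∈ orliczSpace Φ μ) (K : ℝ) :
    orliczModular Φ μ (fun ω => K * X ω) < ⊤ := by
  obtain ⟨c, hc, hm⟩ := exists_modular_le_one hX
  obtain ⟨a, b, hab⟩ := h.exists_mul_le ‖K / c‖₊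
  calc orliczModular Φ μ (fun ω => K * X ω)
      ≤ ∫⁻ ω, ((a : ℝ≥0∞) * (Φ ‖c * X ω‖₊ : ℝ≥0∞) + b) ∂μ := by
        refine lintegral_mono fun ω => ?_
        have e : ‖K * X ω‖₊ = ‖K / c‖₊ * ‖c * X ω‖₊ := by
          rw [← nnnorm_mul]
          congr 1
          field_simp
        rw [e]
        rw [← ENNReal.coe_mul, ← ENNReal.coe_add, ENNReal.coe_le_coe]
        exact hab _
    _ = (a : ℝ≥0∞) * orliczModular Φ μ (fun ω => c * X ω) + b * μ Set.univ := by
        rw [lintegral_add_right _ measurable_const, lintegral_const_mul' _ _ ENNReal.coe_ne_top,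
          lintegral_const]
        rfl
    _ < ⊤ := by
        refine ENNReal.add_lt_top.2 ⟨ENNReal.mul_lt_top ENNReal.coe_lt_top
          (hm.trans_lt ENNReal.one_lt_top), ENNReal.mul_lt_top ENNReal.coe_lt_top
          (measure_lt_top _ _)⟩

end Modular

/-! ### Small sets in nonatomic spaces -/

section Nonatomic

variable {Ω : Type*} [MeasurableSpace Ω] {μ : Measure Ω}

theorem IsNonatomic.exists_le_half (hμ : IsNonatomic μ) [IsFiniteMeasure μ] {s : Set Ω}
    (hs : MeasurableSet s) (h0 : 0 < μ s) :
    ∃ t ⊆ s, MeasurableSet t ∧ 0 < μ t ∧ μ t ≤ μ s / 2 := by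
  obtain ⟨t, hts, ht, ht0, hlt⟩ := hμ s hs h0
  have hadd : μ t + μ (s \ t) = μ s := by
    rw [← measure_inter_add_sdiff s ht, Set.inter_eq_self_of_subset_right hts]
  by_cases h : μ t ≤ μ s / 2
  · exact ⟨t, hts, ht, ht0, h⟩
  · refine ⟨s \ t, Set.sdiff_subset, hs.diff ht, ?_, ?_⟩
    · by_contra h'
      rw [not_lt, nonpos_iff_eq_zero] at h'
      rw [h', add_zero] at hadd
      exact hlt.ne hadd
    · by_contra h'
      have := ENNReal.add_lt_add (not_le.1 h) (not_le.1 h')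
      rw [hadd, ENNReal.add_halves] at this
      exact lt_irrefl _ this

theorem IsNonatomic.exists_lt (hμ : IsNonatomic μ) [IsFiniteMeasure μ] {s : Set Ω}
    (hs : MeasurableSet s) (h0 : 0 < μ s) {ε : ℝ≥0∞} (hε : 0 < ε) :
    ∃ t ⊆ s, MeasurableSet t ∧ 0 < μ t ∧ μ t < ε := by
  have key : ∀ n : ℕ, ∃ t ⊆ s, MeasurableSet t ∧ 0 < μ t ∧ μ t ≤ μ s * 2⁻¹ ^ n := by
    intro n
    induction n with
    | zero => exact ⟨s, le_rfl, hs, h0, by simp⟩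
    | succ n ih =>
      obtain ⟨t, hts, ht, ht0, hle⟩ := ih
      obtain ⟨u, hut, hu, hu0, hule⟩ := hμ.exists_le_half ht ht0
      refine ⟨u, hut.trans hts, hu, hu0, hule.trans ?_⟩
      rw [div_eq_mul_inv, pow_succ, ← mul_assoc]
      gcongr
  have hlim : Tendsto (fun n : ℕ => μ s * 2⁻¹ ^ n) atTop (𝓝 0) := by
    simpa using ENNReal.Tendsto.const_mul
      (ENNReal.tendsto_pow_atTop_nhds_zero_of_lt_one (r := 2⁻¹) (by simp))
      (Or.inr (measure_ne_top μ s))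
  obtain ⟨n, hn⟩ := (hlim.eventually_lt_const hε).exists
  obtain ⟨t, h1, h2, h3, h4⟩ := key n
  exact ⟨t, h1, h2, h3, h4.trans_lt hn⟩

/-- An approximate form of Sierpiński's theorem. -/
theorem IsNonatomic.exists_half_le_le (hμ : IsNonatomic μ) [IsFiniteMeasure μ] {c : ℝ≥0∞}
    (hc0 : 0 < c) (hc : c ≤ μ Set.univ) :
    ∃ t, MeasurableSet t ∧ c / 2 ≤ μ t ∧ μ t ≤ c := by
  -- If no measure falls in `[c/2, c]`, sets of measure at most `c` have measure below `c/2`, so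
  -- they are closed under unions. The union of a maximizing sequence then attains the supremum, yet
  -- a small piece of its complement can still be added.
  by_contra! hcon
  have hctop : c ≠ ⊤ := ne_top_of_le_ne_top (measure_ne_top μ _) hc
  have hsmall : ∀ t, MeasurableSet t → μ t ≤ c → μ t < c / 2 := fun t ht hle => by
    by_contra h
    exact (hcon t ht (not_lt.1 h)).not_ge hle
  have hunion : ∀ s t, MeasurableSet s → MeasurableSet t → μ s ≤ c → μ t ≤ c → μ (s ∪ t) ≤ c := by
    intro s t hs ht hsc htc
    calc μ (s ∪ t) ≤ μ s + μ t := measure_union_le _ _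
      _ ≤ c / 2 + c / 2 := add_le_add (hsmall s hs hsc).le (hsmall t ht htc).le
      _ = c := ENNReal.add_halves c
  let S : Set ℝ≥0∞ := {r | ∃ t, MeasurableSet t ∧ μ t ≤ c ∧ μ t = r}
  have hSne : S.Nonempty := ⟨0, ∅, MeasurableSet.empty, by simp, by simp⟩
  obtain ⟨u, -, hu, huS⟩ := exists_seq_tendsto_sSup hSne (OrderTop.bddAbove S)
  choose A hA hAc hAu using huS
  let U : ℕ → Set Ω := fun n => ⋃ i ≤ n, A i
  have hU : ∀ n, MeasurableSet (U n) := fun n => MeasurableSet.biUnion (Set.to_countable _)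
    fun i _ => hA i
  have hUsucc : ∀ n, U (n + 1) = U n ∪ A (n + 1) := fun n => Set.biUnion_le_succ A n
  have hUc : ∀ n, μ (U n) ≤ c := by
    intro n
    induction n with
    | zero => simpa [U] using hAc 0
    | succ n ih => rw [hUsucc]; exact hunion _ _ (hU n) (hA _) ih (hAc _)
  have hUmono : Monotone U := monotone_nat_of_le_succ fun n => by
    rw [hUsucc]; exact Set.subset_union_left
  let V := ⋃ n, U n
  have hV : MeasurableSet V := MeasurableSet.iUnion hU
  have hVc : μ V ≤ c := by
    rw [hUmono.measure_iUnion]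
    exact iSup_le hUc
  have hVsup : sSup S ≤ μ V := le_of_tendsto' hu fun n => by
    rw [← hAu]
    exact measure_mono ((Set.subset_biUnion_of_mem (u := A) (Set.mem_Iic.2 le_rfl)).trans
      (Set.subset_iUnion U n))
  have hVlt := hsmall V hV hVc
  have hcompl : 0 < μ Vᶜ := by
    by_contra h
    rw [not_lt, nonpos_iff_eq_zero] at h
    have := measure_add_measure_compl hV (μ := μ)
    rw [h, add_zero] at this
    rw [← this] at hc
    exact (hVlt.trans_le ENNReal.half_le_self).not_ge hc
  obtain ⟨t, htV, ht, ht0, htc⟩ := hμ.exists_lt hV.compl hcompl hc0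
  have h1 : μ (V ∪ t) = μ V + μ t :=
    measure_union (Set.disjoint_left.2 fun x hx hx' => htV hx' hx) ht
  have h2 : μ (V ∪ t) ≤ sSup S :=
    le_sSup ⟨V ∪ t, hV.union ht, hunion _ _ hV ht hVc htc.le, rfl⟩
  rw [h1] at h2
  exact (ENNReal.lt_add_right (measure_ne_top μ V) ht0.ne').not_ge (h2.trans hVsup)

end Nonatomic

/-! ### Order limits are weak limits -/

section WeakTopology

variable {Ω : Type*} [MeasurableSpace Ω] {μ : Measure Ω} {Φ Ψ : OrliczFunction}

theorem orliczPairing_apply (h : Φ.IsConjugate Ψ) (X : orliczSpace Φ μ) (Y : orliczSpace Ψ μ) :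
    orliczPairing h μ X Y = ∫ ω, (X : Ω →ₘ[μ] ℝ) ω * (Y : Ω →ₘ[μ] ℝ) ω ∂μ := rfl

theorem continuous_orliczPairing (h : Φ.IsConjugate Ψ) (Y : orliczSpace Ψ μ) :
    @Continuous _ _ (WeakBilin.instTopologicalSpace (orliczPairing h μ)) _
      (fun X => orliczPairing h μ X Y) :=
  WeakBilin.eval_continuous (orliczPairing h μ) Y

/-- Dominated convergence with majorant `|B Y|`, integrable by Young's inequality. -/
theorem OrderConverges.tendsto_pairing (h : Φ.IsConjugate Ψ) {X : ℕ → orliczSpace Φ μ}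
    {Z : orliczSpace Φ μ} (hXZ : OrderConverges X Z) (Y : orliczSpace Ψ μ) :
    Tendsto (fun n => orliczPairing h μ (X n) Y) atTop (𝓝 (orliczPairing h μ Z Y)) := by
  obtain ⟨hlim, B, hB⟩ := hXZ
  simp only [orliczPairing_apply]
  refine tendsto_integral_of_dominated_convergence
    (fun ω => ‖(B : Ω →ₘ[μ] ℝ) ω * (Y : Ω →ₘ[μ] ℝ) ω‖)
    (fun n => (integrable_orlicz_mul h (X n) Y).aestronglyMeasurable)
    (integrable_orlicz_mul h B Y).norm (fun n => ?_) ?_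
  · filter_upwards [hB n] with ω hω
    rw [norm_mul, norm_mul]
    gcongr
    exact hω.trans (le_abs_self _)
  · filter_upwards [hlim] with ω hω using hω.mul_const _

theorem orderClosure_subset_weakClosure (h : Φ.IsConjugate Ψ) (C : Set (orliczSpace Φ μ)) :
    orderClosure C ⊆ weakClosure h C := by
  rintro Z ⟨X, hXC, hXZ⟩
  have hind : @IsInducing _ _ (WeakBilin.instTopologicalSpace (orliczPairing h μ)) _
    (fun (X : WeakBilin (orliczPairing h μ)) Y => orliczPairing h μ X Y) := ⟨rfl⟩
  exact mem_closure_of_tendsto (X := WeakBilin (orliczPairing h μ)) (b := atTop)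
    (hind.tendsto_nhds_iff.2 (tendsto_pi_nhds.2 fun Y => hXZ.tendsto_pairing h Y))
    (Eventually.of_forall hXC)

/-- Idempotence is exactly what the order closure lacks in the counterexample. -/
theorem weakClosure_weakClosure (h : Φ.IsConjugate Ψ) (C : Set (orliczSpace Φ μ)) :
    weakClosure h (weakClosure h C) = weakClosure h C :=
  @closure_closure _ (WeakBilin.instTopologicalSpace (orliczPairing h μ)) C

end WeakTopology

/-! ### The convex set of the counterexample -/

section TailDominating

variable {Ω : Type*}

theorem tail_indicator_antitone {X : Ω → ℝ} (hX : ∀ ω, 0 ≤ X ω) (ω : Ω) :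
    Antitone fun m : ℕ => {ω | (m : ℝ) ≤ X ω}.indicator X ω := by
  intro m n hmn
  refine Set.indicator_le_indicator_of_subset (fun ω' hω' => ?_) hX ω
  exact le_trans (Nat.cast_le.2 hmn) (show (n : ℝ) ≤ X ω' from hω')

variable [MeasurableSpace Ω] {μ : Measure Ω} {Φ : OrliczFunction}

/-- The set of all `Z` with `a + b X 1_{X ≥ m} ≤ Z` for some `m` and positive `a`, `b` with
`1 ≤ a b`. -/
def tailDominatingSet (Φ : OrliczFunction) (μ : Measure Ω) (X : Ω → ℝ) :
    Set (orliczSpace Φ μ) :=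
  {Z | ∃ a b : ℝ, 0 < a ∧ 0 < b ∧ 1 ≤ a * b ∧ ∃ m : ℕ, ∀ᵐ ω ∂μ,
    a + b * {ω | (m : ℝ) ≤ X ω}.indicator X ω ≤ (Z : Ω →ₘ[μ] ℝ) ω}

/-- The region `a b ≥ 1` of the positive quadrant is convex, and tails decrease in `m`, so the
larger threshold serves both points. -/
theorem convex_tailDominatingSet {X : Ω → ℝ} (hX : ∀ ω, 0 ≤ X ω) :
    Convex ℝ (tailDominatingSet Φ μ X) := by
  rintro Z₁ ⟨a₁, b₁, ha₁, hb₁, hab₁, m₁, h₁⟩ Z₂ ⟨a₂, b₂, ha₂, hb₂, hab₂, m₂, h₂⟩ p q hp hq hpq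
  have hpos : ∀ x y : ℝ, 0 < x → 0 < y → 0 < p * x + q * y := by
    intro x y hx hy
    rcases hp.eq_or_lt with rfl | hp'
    · have : q = 1 := by linarith
      subst this
      linarith
    · have := mul_nonneg hq hy.le
      have := mul_pos hp' hx
      linarith
  refine ⟨p * a₁ + q * a₂, p * b₁ + q * b₂, hpos _ _ ha₁ ha₂, hpos _ _ hb₁ hb₂, ?_,
    max m₁ m₂, ?_⟩
  -- The two cross terms have product at least `1`, hence sum at least `2` by AM-GM; the product
  -- then dominates `(p + q) ^ 2 = 1`.
  · have hcross : 2 ≤ a₁ * b₂ + a₂ * b₁ := by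
      have hprod : 1 ≤ (a₁ * b₂) * (a₂ * b₁) := by
        calc (1 : ℝ) ≤ (a₁ * b₁) * (a₂ * b₂) := one_le_mul_of_one_le_of_one_le hab₁ hab₂
          _ = _ := by ring
      have := mul_pos ha₁ hb₂
      have := mul_pos ha₂ hb₁
      nlinarith [sq_nonneg (a₁ * b₂ - a₂ * b₁)]
    have e : (p * a₁ + q * a₂) * (p * b₁ + q * b₂) =
        p ^ 2 * (a₁ * b₁) + q ^ 2 * (a₂ * b₂) + p * q * (a₁ * b₂ + a₂ * b₁) := by ring
    have e1 : (1 : ℝ) = p ^ 2 * 1 + q ^ 2 * 1 + p * q * 2 := by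
      calc (1 : ℝ) = (p + q) ^ 2 := by rw [hpq]; norm_num
        _ = _ := by ring
    rw [e, e1]
    gcongr
  · filter_upwards [h₁, h₂, AEEqFun.coeFn_add (p • (Z₁ : Ω →ₘ[μ] ℝ)) (q • (Z₂ : Ω →ₘ[μ] ℝ)),
      AEEqFun.coeFn_smul p (Z₁ : Ω →ₘ[μ] ℝ), AEEqFun.coeFn_smul q (Z₂ : Ω →ₘ[μ] ℝ)]
      with ω hω₁ hω₂ hadd hs₁ hs₂
    have hZ : ((p • Z₁ + q • Z₂ : orliczSpace Φ μ) : Ω →ₘ[μ] ℝ) ω =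
        p * (Z₁ : Ω →ₘ[μ] ℝ) ω + q * (Z₂ : Ω →ₘ[μ] ℝ) ω := by
      rw [Submodule.coe_add, Submodule.coe_smul, Submodule.coe_smul, hadd, Pi.add_apply, hs₁, hs₂]
      rfl
    rw [hZ]
    have hm₁ := tail_indicator_antitone hX ω (le_max_left m₁ m₂)
    have hm₂ := tail_indicator_antitone hX ω (le_max_right m₁ m₂)
    simp only at hm₁ hm₂
    calc _ = p * (a₁ + b₁ * {ω | ((max m₁ m₂ : ℕ) : ℝ) ≤ X ω}.indicator X ω) +
          q * (a₂ + b₂ * {ω | ((max m₁ m₂ : ℕ) : ℝ) ≤ X ω}.indicator X ω) := by ring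
      _ ≤ p * (a₁ + b₁ * {ω | (m₁ : ℝ) ≤ X ω}.indicator X ω) +
          q * (a₂ + b₂ * {ω | (m₂ : ℝ) ≤ X ω}.indicator X ω) := by gcongr
      _ ≤ _ := by gcongr

end TailDominating

/-! ### Necessity of the Δ₂-condition -/

section NotDeltaTwo

variable {Ω : Type*} [MeasurableSpace Ω] {μ : Measure Ω} [IsProbabilityMeasure μ]
  {Φ Ψ : OrliczFunction}

theorem OrliczFunction.exists_pow_mul_le_of_not_deltaTwo (hΦ : ∀ t : ℝ≥0, 0 < t → 0 < Φ t)
    (h : ¬ Φ.DeltaTwo) (n : ℕ) : ∃ t : ℝ≥0, 1 ≤ Φ t ∧ 4 ^ n * Φ t ≤ Φ (2 * t) := by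
  obtain ⟨T, hT⟩ := ((OrliczFunction.tendsto_atTop hΦ).eventually_ge_atTop 1).exists
  have hT0 : 0 < T := by
    rcases eq_or_ne T 0 with rfl | h0
    · simp [Φ.map_zero] at hT
    · exact pos_iff_ne_zero.2 h0
  unfold DeltaTwo at h
  push Not at h
  obtain ⟨t, ht, hle⟩ := h T hT0 (4 ^ n)
  exact ⟨t, hT.trans (Φ.monotone ht), by exact_mod_cast hle⟩

/-- Take `t n` with `Φ(2 t n) ≥ 4^n Φ(t n)` and sets `A n` of measure comparable to `c n = 2^{-n} /
Φ(t n)`. With `X` the supremum of the `t n 1_{A n}`, the modular of `X` is at most `∑ 2^{-n}`, while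
`A n` alone contributes at least `2^n / 2` to that of `2X`. -/
theorem exists_modular_two_mul_eq_top (hμ : IsNonatomic μ) (hΦ : ∀ t : ℝ≥0, 0 < t → 0 < Φ t)
    (h : ¬ Φ.DeltaTwo) :
    ∃ X : Ω → ℝ, Measurable X ∧ (∀ ω, 0 ≤ X ω) ∧ orliczModular Φ μ X < ⊤ ∧
      orliczModular Φ μ (fun ω => 2 * X ω) = ⊤ := by
  choose t ht1 ht using OrliczFunction.exists_pow_mul_le_of_not_deltaTwo hΦ h
  let c : ℕ → ℝ≥0 := fun n => (2⁻¹) ^ n * (Φ (t n))⁻¹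
  have hΦ0 : ∀ n, Φ (t n) ≠ 0 := fun n => (zero_lt_one.trans_le (ht1 n)).ne'
  have hc0 : ∀ n, 0 < c n := fun n => by
    have := pos_iff_ne_zero.2 (hΦ0 n)
    positivity
  have hcΦ : ∀ n, Φ (t n) * c n = 2⁻¹ ^ n := fun n => by
    have := hΦ0 n
    simp only [c]
    field_simp
  have hc2 : ∀ n, c n ≤ 2⁻¹ ^ n := fun n =>
    mul_le_of_le_one_right' (inv_le_one_of_one_le₀ (ht1 n))
  have hc1 : ∀ n, (c n : ℝ≥0∞) ≤ μ Set.univ := fun n => by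
    rw [measure_univ]
    exact_mod_cast (hc2 n).trans (pow_le_one' (inv_le_one_of_one_le₀ one_le_two) n)
  have hsum : ∑' n : ℕ, ((2⁻¹ ^ n : ℝ≥0) : ℝ≥0∞) ≠ ⊤ := by
    rw [ENNReal.tsum_coe_ne_top_iff_summable]
    exact NNReal.summable_geometric (inv_lt_one_of_one_lt₀ one_lt_two)
  choose A hA hAl hAu using fun n =>
    hμ.exists_half_le_le (by exact_mod_cast hc0 n : (0 : ℝ≥0∞) < c n) (hc1 n)
  -- Borel–Cantelli. The supremum below is then almost surely a maximum, so the `A n` need not be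
  -- disjoint and `toReal` loses nothing.
  have hfin : ∀ᵐ ω ∂μ, {n | ω ∈ A n}.Finite := ae_finite_setOfPred_mem
    (ne_top_of_le_ne_top hsum (ENNReal.tsum_le_tsum fun n => (hAu n).trans
      (by exact_mod_cast hc2 n)))
  let G : Ω → ℝ≥0∞ := fun ω => ⨆ n, (A n).indicator (fun _ => (t n : ℝ≥0∞)) ω
  have hG : Measurable G := Measurable.iSup fun n => measurable_const.indicator (hA n)
  have hGcase : ∀ ω, {n | ω ∈ A n}.Finite → G ω = 0 ∨ ∃ n, ω ∈ A n ∧ G ω = t n := by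
    intro ω hω
    rcases Set.eq_empty_or_nonempty {n | ω ∈ A n} with he | hne
    · left
      have : ∀ n, ω ∉ A n := fun n hn => by
        have : n ∈ ({n | ω ∈ A n} : Set ℕ) := hn
        simp [he] at this
      simp [G, this]
    · right
      obtain ⟨n, hn, hmax⟩ := Set.exists_max_image _ t hω hne
      refine ⟨n, hn, le_antisymm (iSup_le fun k => ?_) ?_⟩
      · by_cases hk : ω ∈ A k
        · rw [Set.indicator_of_mem hk]
          exact_mod_cast hmax k hk
        · simp [hk]
      · refine le_iSup_of_le n ?_
        rw [Set.indicator_of_mem (show ω ∈ A n from hn)]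
  refine ⟨fun ω => (G ω).toReal, hG.ennreal_toReal, fun ω => ENNReal.toReal_nonneg, ?_, ?_⟩
  · have hle : ∀ᵐ ω ∂μ, (Φ ‖(G ω).toReal‖₊ : ℝ≥0∞) ≤
        ∑' n, (A n).indicator (fun _ => (Φ (t n) : ℝ≥0∞)) ω := by
      filter_upwards [hfin] with ω hω
      rcases hGcase ω hω with h0 | ⟨n, hn, hGn⟩
      · simp [h0, Φ.map_zero]
      · refine le_trans ?_ (ENNReal.le_tsum n)
        rw [Set.indicator_of_mem hn, hGn]
        simp
    refine (lintegral_mono_ae hle).trans_lt ?_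
    rw [lintegral_tsum fun n => (measurable_const.indicator (hA n)).aemeasurable]
    refine lt_of_le_of_lt (ENNReal.tsum_le_tsum fun n => ?_) (lt_top_iff_ne_top.2 hsum)
    rw [lintegral_indicator_const (hA n)]
    calc (Φ (t n) : ℝ≥0∞) * μ (A n) ≤ Φ (t n) * c n := by gcongr; exact hAu n
      _ = _ := by rw [← ENNReal.coe_mul, hcΦ]
  · refine ENNReal.eq_top_of_forall_nnreal_le fun r => ?_
    obtain ⟨n, hn⟩ := pow_unbounded_of_one_lt (2 * r) (one_lt_two : (1 : ℝ≥0) < 2)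
    have hle : ∀ᵐ ω ∂μ, (A n).indicator (fun _ => (Φ (2 * t n) : ℝ≥0∞)) ω ≤
        (Φ ‖2 * (G ω).toReal‖₊ : ℝ≥0∞) := by
      filter_upwards [hfin] with ω hω
      by_cases hn : ω ∈ A n
      · rw [Set.indicator_of_mem hn, ENNReal.coe_le_coe]
        refine Φ.monotone ?_
        have h1 : (t n : ℝ≥0∞) ≤ G ω := le_iSup_of_le n (by rw [Set.indicator_of_mem hn])
        have h2 : G ω ≠ ⊤ := by
          rcases hGcase ω hω with h0 | ⟨k, -, hk⟩
          · simp [h0]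
          · simp [hk]
        have h3 : (t n : ℝ) ≤ (G ω).toReal := by
          simpa using ENNReal.toReal_mono h2 h1
        rw [← NNReal.coe_le_coe]
        push_cast
        rw [Real.norm_eq_abs, abs_of_nonneg (by positivity)]
        linarith
      · simp [hn]
    refine le_trans ?_ (lintegral_mono_ae hle)
    rw [lintegral_indicator_const (hA n)]
    have hr : r ≤ Φ (2 * t n) * (c n / 2) := by
      calc r ≤ 2 ^ n / 2 := by rw [le_div_iff₀ two_pos, mul_comm]; exact hn.le
        _ = 4 ^ n * 2⁻¹ ^ n / 2 := by
          congr 1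
          rw [← mul_pow]
          norm_num
        _ = 4 ^ n * (Φ (t n) * c n) / 2 := by rw [hcΦ]
        _ = (4 ^ n * Φ (t n)) * (c n / 2) := by ring
        _ ≤ _ := by gcongr; exact ht n
    calc (r : ℝ≥0∞) ≤ Φ (2 * t n) * ((c n : ℝ≥0∞) / 2) := by
          have : ((c n : ℝ≥0∞) / 2) = ((c n / 2 : ℝ≥0) : ℝ≥0∞) := by
            rw [ENNReal.coe_div two_ne_zero]; rfl
          rw [this]
          exact_mod_cast hr
      _ ≤ _ := by gcongr; exact hAl n

theorem zero_mem_weakClosure_tailDominatingSet (h : Φ.IsConjugate Ψ) {X : Ω → ℝ}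
    (hXm : Measurable X) (hX : ∀ ω, 0 ≤ X ω) (hXfin : orliczModular Φ μ X < ⊤) :
    (0 : orliczSpace Φ μ) ∈ weakClosure h (tailDominatingSet Φ μ X) := by
  have hconst : ∀ a : ℝ, AEEqFun.const Ω a ∈ orliczSpace Φ μ := fun a =>
    mem_orliczSpace_of_bound (C := |a|) (by
      filter_upwards [AEEqFun.coeFn_const Ω a (μ := μ)] with ω hω
      rw [hω]; rfl)
  let T : ℕ → Set Ω := fun m => {ω | (m : ℝ) ≤ X ω}
  have hT : ∀ m, MeasurableSet (T m) := fun m => measurableSet_le measurable_const hXm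
  have hXmem : AEEqFun.mk X hXm.aestronglyMeasurable ∈ orliczSpace Φ μ :=
    mem_orliczSpace_of_modular one_pos (by
      rw [orliczModular_congr (Y := X)]
      · exact hXfin
      · filter_upwards [AEEqFun.coeFn_mk X hXm.aestronglyMeasurable (μ := μ)] with ω hω
        rw [hω, one_mul])
  -- First limit: `a + a⁻¹ X 1_{X ≥ m}` decreases to `a` as `m` grows and is dominated by its term
  -- at `m = 0`.
  have hstep : ∀ a : ℝ, 0 < a →
      (⟨AEEqFun.const Ω a, hconst a⟩ : orliczSpace Φ μ) ∈
        weakClosure h (tailDominatingSet Φ μ X) := by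
    intro a ha
    refine orderClosure_subset_weakClosure h _ ?_
    let W : ℕ → Ω → ℝ := fun m => (T m).indicator X
    have hWm : ∀ m, AEStronglyMeasurable (W m) μ := fun m =>
      (hXm.indicator (hT m)).aestronglyMeasurable
    have hWle : ∀ m ω, W m ω ≤ X ω := fun m ω => Set.indicator_le_self' (fun _ _ => hX _) ω
    have hW0 : ∀ m ω, 0 ≤ W m ω := fun m ω => Set.indicator_nonneg (fun _ _ => hX _) ω
    have hWmem : ∀ m, AEEqFun.mk (W m) (hWm m) ∈ orliczSpace Φ μ := fun m =>
      mem_orliczSpace_of_le hXmem (by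
        filter_upwards [AEEqFun.coeFn_mk X hXm.aestronglyMeasurable (μ := μ),
          AEEqFun.coeFn_mk (W m) (hWm m)] with ω h1 h2
        rw [h1, h2, abs_of_nonneg (hW0 m ω), abs_of_nonneg (hX ω)]
        exact hWle m ω)
    let Z : ℕ → orliczSpace Φ μ := fun m =>
      ⟨AEEqFun.const Ω a, hconst a⟩ + a⁻¹ • ⟨AEEqFun.mk (W m) (hWm m), hWmem m⟩
    have hZ : ∀ m, ∀ᵐ ω ∂μ, (Z m : Ω →ₘ[μ] ℝ) ω = a + a⁻¹ * W m ω := by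
      intro m
      filter_upwards [AEEqFun.coeFn_mk (W m) (hWm m), AEEqFun.coeFn_const Ω a (μ := μ),
        AEEqFun.coeFn_smul a⁻¹ (AEEqFun.mk (W m) (hWm m)),
        AEEqFun.coeFn_add (AEEqFun.const Ω a) (a⁻¹ • AEEqFun.mk (W m) (hWm m))] with ω h1 h2 h3 h4
      change (AEEqFun.const Ω a + a⁻¹ • AEEqFun.mk (W m) (hWm m) : Ω →ₘ[μ] ℝ) ω = _
      rw [h4, Pi.add_apply, h3, Pi.smul_apply, h1, h2]
      rfl
    refine ⟨Z, fun m => ⟨a, a⁻¹, ha, inv_pos.2 ha, (mul_inv_cancel₀ ha.ne').ge, m, ?_⟩, ?_,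
      Z 0, fun m => ?_⟩
    · filter_upwards [hZ m] with ω hω
      rw [hω]
    · filter_upwards [ae_all_iff.2 hZ, AEEqFun.coeFn_const Ω a (μ := μ)] with ω hω hc
      have hlim : Tendsto (fun m => W m ω) atTop (𝓝 0) := by
        obtain ⟨N, hN⟩ := exists_nat_gt (X ω)
        refine tendsto_const_nhds.congr' ?_
        filter_upwards [eventually_ge_atTop N] with m hm
        refine (Set.indicator_of_notMem (fun hmem : ω ∈ T m => ?_) X).symm
        have hmem' : (m : ℝ) ≤ X ω := hmem
        have : (N : ℝ) ≤ m := by exact_mod_cast hm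
        linarith
      simp only [hω, hc, Function.const_apply]
      simpa using (hlim.const_mul a⁻¹).const_add a
    · filter_upwards [hZ m, hZ 0] with ω h1 h2
      have h3 := hW0 m ω
      have h4 : W m ω ≤ W 0 ω := tail_indicator_antitone hX ω (Nat.zero_le m)
      rw [h1, h2, abs_of_nonneg (by positivity)]
      gcongr
  -- Second limit: the constants `1 / (n + 1)` lie in the weak closure and tend to `0`.
  rw [← weakClosure_weakClosure]
  refine orderClosure_subset_weakClosure h _ ⟨fun n => ⟨AEEqFun.const Ω (1 / ((n : ℝ) + 1)),
    hconst _⟩, fun n => hstep _ (by positivity), ?_, ⟨AEEqFun.const Ω 1, hconst 1⟩, fun n => ?_⟩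
  · filter_upwards [ae_all_iff.2 fun n : ℕ =>
      AEEqFun.coeFn_const Ω (1 / ((n : ℝ) + 1)) (μ := μ), AEEqFun.coeFn_zero (μ := μ) (β := ℝ)]
      with ω h1 h2
    simp only [h1, Submodule.coe_zero, h2, Function.const_apply, Pi.zero_apply]
    exact tendsto_one_div_add_atTop_nhds_zero_nat
  · filter_upwards [AEEqFun.coeFn_const Ω (1 / ((n : ℝ) + 1)) (μ := μ),
      AEEqFun.coeFn_const Ω (1 : ℝ) (μ := μ)] with ω h1 h2
    rw [h1, h2, Function.const_apply, Function.const_apply, abs_of_nonneg (by positivity)]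
    rw [div_le_one (by positivity)]
    linarith [(Nat.cast_nonneg n : (0 : ℝ) ≤ n)]

/-- Let `E[Φ(c B)] ≤ 1` for the order bound `B`. If `c b n ≥ 2`, then `2X ≤ c B` where `X ≥ m n` and
`2X ≤ 2 m n` elsewhere, so `E[Φ(2X)]` would be finite. Hence `b n < 2 / c`, and `a n b n ≥ 1` forces
`Z n ≥ a n ≥ c / 2`. -/
theorem zero_notMem_orderClosure_tailDominatingSet {X : Ω → ℝ} (hX : ∀ ω, 0 ≤ X ω)
    (hXtop : orliczModular Φ μ (fun ω => 2 * X ω) = ⊤) :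
    (0 : orliczSpace Φ μ) ∉ orderClosure (tailDominatingSet Φ μ X) := by
  rintro ⟨Z, hZ, hlim, B, hB⟩
  choose a b ha hb hab m hle using hZ
  obtain ⟨c, hc, hmod⟩ := exists_modular_le_one B.2
  have hbound : ∀ n, c * b n < 2 := by
    intro n
    by_contra hcon
    rw [not_lt] at hcon
    have key : orliczModular Φ μ (fun ω => 2 * X ω) ≤
        orliczModular Φ μ (fun ω => c * (B : Ω →ₘ[μ] ℝ) ω) + Φ (2 * m n) := by
      calc orliczModular Φ μ (fun ω => 2 * X ω)
          ≤ ∫⁻ ω, ((Φ ‖c * (B : Ω →ₘ[μ] ℝ) ω‖₊ : ℝ≥0∞) + Φ (2 * m n)) ∂μ := by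
            refine lintegral_mono_ae ?_
            filter_upwards [hle n, hB n] with ω h1 h2
            rcases le_total (m n : ℝ) (X ω) with hm | hm
            · refine le_add_right (ENNReal.coe_le_coe.2 (Φ.monotone ?_))
              rw [Set.indicator_of_mem (show ω ∈ {ω | (m n : ℝ) ≤ X ω} from hm)] at h1
              have h3 : b n * X ω ≤ (B : Ω →ₘ[μ] ℝ) ω := by
                have := (le_abs_self _).trans h2
                linarith [ha n]
              rw [← NNReal.coe_le_coe, coe_nnnorm, coe_nnnorm, Real.norm_eq_abs,
                Real.norm_eq_abs, abs_of_nonneg (mul_nonneg zero_le_two (hX ω))]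
              calc 2 * X ω ≤ (c * b n) * X ω := by gcongr; exact hX ω
                _ = c * (b n * X ω) := by ring
                _ ≤ c * (B : Ω →ₘ[μ] ℝ) ω := by gcongr
                _ ≤ _ := le_abs_self _
            · refine le_add_left (ENNReal.coe_le_coe.2 (Φ.monotone ?_))
              rw [← NNReal.coe_le_coe, coe_nnnorm, Real.norm_eq_abs,
                abs_of_nonneg (mul_nonneg zero_le_two (hX ω))]
              push_cast
              gcongr
        _ = _ := by
            rw [lintegral_add_right _ measurable_const, lintegral_const, measure_univ, mul_one]
            rfl
    rw [hXtop, top_le_iff] at key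
    exact (ENNReal.add_lt_top.2 ⟨hmod.trans_lt ENNReal.one_lt_top, ENNReal.coe_lt_top⟩).ne key
  have hale : ∀ n, c / 2 ≤ a n := by
    intro n
    have h1 := hbound n
    have h2 : c ≤ a n * (c * b n) := by nlinarith [hab n]
    have h3 : a n * (c * b n) ≤ a n * 2 := by gcongr; exact (ha n).le
    linarith
  have hfalse : ∀ᵐ ω ∂μ, False := by
    filter_upwards [hlim, ae_all_iff.2 hle, AEEqFun.coeFn_zero (μ := μ) (β := ℝ)] with ω h1 h2 h3
    rw [Submodule.coe_zero, h3] at h1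
    have h4 : c / 2 ≤ (0 : ℝ) := ge_of_tendsto' h1 fun n => by
      have h5 : 0 ≤ {ω | (m n : ℝ) ≤ X ω}.indicator X ω := Set.indicator_nonneg (fun _ _ => hX _) ω
      have h6 := mul_nonneg (hb n).le h5
      linarith [hale n, h2 n]
    linarith
  exact hfalse.exists.choose_spec

theorem deltaTwo_of_orderClosure_eq_weakClosure (hμ : IsNonatomic μ)
    (hΦ : ∀ t : ℝ≥0, 0 < t → 0 < Φ t) (h : Φ.IsConjugate Ψ)
    (hC : ∀ C : Set (orliczSpace Φ μ), Convex ℝ C → orderClosure C = weakClosure h C) :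
    Φ.DeltaTwo := by
  by_contra hΔ
  obtain ⟨X, hXm, hX, hfin, htop⟩ := exists_modular_two_mul_eq_top hμ hΦ hΔ
  refine zero_notMem_orderClosure_tailDominatingSet hX htop ?_
  rw [hC _ (convex_tailDominatingSet hX)]
  exact zero_mem_weakClosure_tailDominatingSet h hXm hX hfin

end NotDeltaTwo

/-! ### Representing functionals by elements of `L^Ψ` -/

section Representation

variable {Ω : Type*} [MeasurableSpace Ω] {μ : Measure Ω} {Φ Ψ : OrliczFunction}
  {F : (Ω →ₘ[μ] ℝ) →ₗ[ℝ] ℝ} {M : ℝ}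

theorem tendsto_of_tendsto_modular {ι : Type*} {l : Filter ι}
    (hF : ∀ W : Ω →ₘ[μ] ℝ, orliczModular Φ μ W ≤ 1 → |F W| ≤ M) {W : ι → Ω →ₘ[μ] ℝ}
    (hW : ∀ K : ℝ, Tendsto (fun i => orliczModular Φ μ (fun ω => K * W i ω)) l (𝓝 0)) :
    Tendsto (fun i => F (W i)) l (𝓝 0) := by
  rw [Metric.tendsto_nhds]
  intro ε hε
  -- Chosen so that `|F (W i)| ≥ ε` would give `|F (K • W i)| ≥ |M| + 1`.
  set K := (|M| + 1) / ε
  have hK : 0 < K := by positivity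
  filter_upwards [(hW K).eventually_le_const one_pos] with i hi
  have h1 : orliczModular Φ μ (K • W i : Ω →ₘ[μ] ℝ) ≤ 1 := by
    rw [orliczModular_congr (AEEqFun.coeFn_smul K (W i))]
    exact hi
  have h2 := hF _ h1
  rw [map_smul, smul_eq_mul, abs_mul, abs_of_pos hK] at h2
  rw [Real.dist_eq, sub_zero]
  by_contra hcon
  rw [not_lt] at hcon
  have h3 : K * ε ≤ M := (mul_le_mul_of_nonneg_left hcon hK.le).trans h2
  rw [div_mul_cancel₀ _ hε.ne'] at h3
  linarith [le_abs_self M]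

/-- The majorant must have finite modular at every scale: constants always do on a probability
space, elements of `L^Φ` do under Δ₂. -/
theorem tendsto_of_dominated {ι : Type*} {l : Filter ι} [l.IsCountablyGenerated]
    (hF : ∀ W : Ω →ₘ[μ] ℝ, orliczModular Φ μ W ≤ 1 → |F W| ≤ M) {W : ι → Ω →ₘ[μ] ℝ} {Z : Ω →ₘ[μ] ℝ}
    {B : Ω → ℝ} (hB : ∀ K : ℝ, orliczModular Φ μ (fun ω => K * B ω) < ⊤)
    (hle : ∀ i, ∀ᵐ ω ∂μ, |W i ω - Z ω| ≤ |B ω|)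
    (hlim : ∀ᵐ ω ∂μ, Tendsto (fun i => W i ω) l (𝓝 (Z ω))) :
    Tendsto (fun i => F (W i)) l (𝓝 (F Z)) := by
  have key : Tendsto (fun i => F (W i - Z)) l (𝓝 0) := by
    refine tendsto_of_tendsto_modular hF fun K => ?_
    have hcongr : ∀ i, orliczModular Φ μ (fun ω => K * (W i - Z : Ω →ₘ[μ] ℝ) ω) =
        orliczModular Φ μ (fun ω => K * (W i ω - Z ω)) := fun i => by
      refine orliczModular_congr ?_
      filter_upwards [AEEqFun.coeFn_sub (W i) Z] with ω hω
      rw [hω, Pi.sub_apply]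
    simp only [hcongr]
    refine tendsto_orliczModular (fun i => ((W i).aemeasurable.sub Z.aemeasurable).const_mul K)
      (hB K).ne (fun i => ?_) ?_
    · filter_upwards [hle i] with ω hω
      rw [abs_mul, abs_mul]
      gcongr
    · filter_upwards [hlim] with ω hω
      simpa using (hω.sub_const (Z ω)).const_mul K
  simpa using key.add_const (F Z)

/-- The set function `A ↦ F(1_A)` vanishes on null sets and is countably additive, by dominated
continuity with majorant `1`; Radon–Nikodym applies. -/
theorem exists_density [IsProbabilityMeasure μ]
    (hF : ∀ W : Ω →ₘ[μ] ℝ, orliczModular Φ μ W ≤ 1 → |F W| ≤ M) :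
    ∃ Y : Ω → ℝ, Integrable Y μ ∧ ∀ (A : Set Ω) (hA : MeasurableSet A),
      F (AEEqFun.mk (A.indicator fun _ => 1)
        (stronglyMeasurable_const.indicator hA).aestronglyMeasurable) = ∫ ω in A, Y ω ∂μ := by
  classical
  let e : (A : Set Ω) → MeasurableSet A → Ω →ₘ[μ] ℝ := fun A hA =>
    AEEqFun.mk (A.indicator fun _ => 1)
      (stronglyMeasurable_const.indicator hA).aestronglyMeasurable
  have he : ∀ A hA, e A hA =ᵐ[μ] A.indicator fun _ => 1 := fun A hA => AEEqFun.coeFn_mk _ _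
  have he0 : ∀ A hA, μ A = 0 → e A hA = 0 := by
    intro A hA h0
    refine AEEqFun.ext ?_
    filter_upwards [he A hA, AEEqFun.coeFn_zero (μ := μ) (β := ℝ),
      measure_eq_zero_iff_ae_notMem.1 h0] with ω h1 h2 h3
    rw [h1, h2, Set.indicator_of_notMem h3, Pi.zero_apply]
  let ν : SignedMeasure Ω :=
    { measureOf' := fun A => if hA : MeasurableSet A then F (e A hA) else 0
      empty' := by simp [he0]
      not_measurable' := fun A hA => by simp [hA]
      m_iUnion' := by
        intro A hA hd
        have hU : MeasurableSet (⋃ i, A i) := MeasurableSet.iUnion hA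
        simp only [hA, hU, dif_pos]
        have hsum : ∀ s : Finset ℕ, ((∑ i ∈ s, e (A i) (hA i) : Ω →ₘ[μ] ℝ) : Ω → ℝ) =ᵐ[μ]
            fun ω => ∑ i ∈ s, (A i).indicator (fun _ => (1 : ℝ)) ω := by
          intro s
          induction s using Finset.induction_on with
          | empty =>
            filter_upwards [AEEqFun.coeFn_zero (μ := μ) (β := ℝ)] with ω hω
            simp [hω]
          | insert i s hi ih =>
            filter_upwards [ih, he (A i) (hA i),
              AEEqFun.coeFn_add (e (A i) (hA i)) (∑ i ∈ s, e (A i) (hA i))] with ω h1 h2 h3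
            rw [Finset.sum_insert hi, Finset.sum_insert hi, h3, Pi.add_apply, h1, h2]
        have hfin : ∀ (s : Finset ℕ) ω, ∑ i ∈ s, (A i).indicator (fun _ => (1 : ℝ)) ω =
            (⋃ i ∈ s, A i).indicator (fun _ => (1 : ℝ)) ω := fun s ω => by
          rw [Finset.indicator_biUnion_apply]
          exact fun i _ j _ hij => hd hij
        have : Tendsto (fun s : Finset ℕ => F (∑ i ∈ s, e (A i) (hA i))) atTop
            (𝓝 (F (e _ hU))) := by
          refine tendsto_of_dominated hF (B := fun _ => 1) (fun K => ?_) (fun s => ?_) ?_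
          · simp [orliczModular]
          · filter_upwards [hsum s, he _ hU] with ω h1 h2
            rw [h1, h2, hfin, abs_one]
            have hsub : (⋃ i ∈ s, A i) ⊆ ⋃ i, A i := Set.iUnion₂_subset_iUnion _ _
            by_cases hω : ω ∈ ⋃ i ∈ s, A i
            · rw [Set.indicator_of_mem hω, Set.indicator_of_mem (hsub hω)]
              simp
            · rw [Set.indicator_of_notMem hω]
              by_cases hω' : ω ∈ ⋃ i, A i
              · rw [Set.indicator_of_mem hω']; simp
              · rw [Set.indicator_of_notMem hω']; simp
          · have hall : ∀ᵐ ω ∂μ, ∀ s : Finset ℕ, (∑ i ∈ s, e (A i) (hA i) : Ω →ₘ[μ] ℝ) ω =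
                ∑ i ∈ s, (A i).indicator (fun _ => (1 : ℝ)) ω := ae_all_iff.2 hsum
            filter_upwards [hall, he _ hU] with ω h1 h2
            simp only [h1, h2, hfin]
            refine tendsto_const_nhds.congr' ?_
            by_cases hω' : ω ∈ ⋃ i, A i
            · obtain ⟨i, hi⟩ := Set.mem_iUnion.1 hω'
              filter_upwards [eventually_ge_atTop {i}] with s hs
              have his : i ∈ s := Finset.singleton_subset_iff.1 hs
              rw [Set.indicator_of_mem hω',
                Set.indicator_of_mem (Set.mem_iUnion₂.2 ⟨i, his, hi⟩)]
            · refine Eventually.of_forall fun s => ?_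
              have hsub : (⋃ i ∈ s, A i) ⊆ ⋃ i, A i := Set.iUnion₂_subset_iUnion _ _
              change _ = (⋃ i ∈ s, A i).indicator (fun _ => (1 : ℝ)) ω
              rw [Set.indicator_of_notMem hω', Set.indicator_of_notMem fun h => hω' (hsub h)]
        simp only [map_sum] at this
        exact this }
  have hν : ∀ A (hA : MeasurableSet A), ν A = F (e A hA) := fun A hA => dif_pos hA
  have hac : ν ≪ᵥ μ.toENNRealVectorMeasure := by
    refine VectorMeasure.AbsolutelyContinuous.mk fun A hA h0 => ?_
    rw [Measure.toENNRealVectorMeasure_apply_measurable hA] at h0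
    rw [hν A hA, he0 A hA h0, map_zero]
  refine ⟨ν.rnDeriv μ, SignedMeasure.integrable_rnDeriv ν μ, fun A hA => ?_⟩
  rw [← withDensityᵥ_apply (SignedMeasure.integrable_rnDeriv ν μ) hA,
    SignedMeasure.withDensityᵥ_rnDeriv_eq ν μ hac, hν A hA]

/-- Linearity settles simple functions; uniformly bounded simple approximations give the rest, both
sides being continuous along them. -/
theorem eq_integral_of_bound [IsProbabilityMeasure μ]
    (hF : ∀ W : Ω →ₘ[μ] ℝ, orliczModular Φ μ W ≤ 1 → |F W| ≤ M) {Y : Ω → ℝ} (hY : Integrable Y μ)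
    (hYF : ∀ (A : Set Ω) (hA : MeasurableSet A), F (AEEqFun.mk (A.indicator fun _ => 1)
        (stronglyMeasurable_const.indicator hA).aestronglyMeasurable) = ∫ ω in A, Y ω ∂μ)
    {W : Ω →ₘ[μ] ℝ} {C : ℝ} (hW : ∀ᵐ ω ∂μ, |W ω| ≤ C) : F W = ∫ ω, W ω * Y ω ∂μ := by
  have hint : ∀ s : SimpleFunc Ω ℝ, Integrable (fun ω => s ω * Y ω) μ := fun s => by
    obtain ⟨D, hD⟩ := s.exists_forall_norm_le
    exact hY.bdd_mul s.aestronglyMeasurable (Eventually.of_forall hD)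
  have hsimple : ∀ s : SimpleFunc Ω ℝ,
      F (AEEqFun.mk s s.aestronglyMeasurable) = ∫ ω, s ω * Y ω ∂μ := by
    intro s
    induction s using SimpleFunc.induction with
    | const c hA =>
      rename_i A
      have h1 : AEEqFun.mk (μ := μ) (SimpleFunc.piecewise A hA (SimpleFunc.const Ω c)
          (SimpleFunc.const Ω 0)) (SimpleFunc.aestronglyMeasurable _) =
          c • AEEqFun.mk (A.indicator fun _ => 1)
            (stronglyMeasurable_const.indicator hA).aestronglyMeasurable := by
        rw [AEEqFun.smul_mk]
        refine AEEqFun.mk_eq_mk.2 (Eventually.of_forall fun ω => ?_)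
        by_cases hω : ω ∈ A <;> simp [hω]
      rw [h1, map_smul, hYF A hA, ← integral_indicator hA, smul_eq_mul, ← integral_const_mul]
      refine integral_congr_ae (Eventually.of_forall fun ω => ?_)
      by_cases hω : ω ∈ A <;> simp [hω]
    | add hd hf hg =>
      rename_i f g
      have h1 : AEEqFun.mk (μ := μ) (f + g : SimpleFunc Ω ℝ) (SimpleFunc.aestronglyMeasurable _) =
          AEEqFun.mk f f.aestronglyMeasurable + AEEqFun.mk g g.aestronglyMeasurable := by
        rw [AEEqFun.mk_add_mk]
        rfl
      rw [h1, map_add, hf, hg, ← integral_add (hint f) (hint g)]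
      simp [add_mul]
  obtain ⟨ω₀, hω₀⟩ := hW.exists
  have hC : 0 ≤ C := (abs_nonneg _).trans hω₀
  let s : ℕ → SimpleFunc Ω ℝ := W.stronglyMeasurable.approxBounded C
  have hs : ∀ n ω, |s n ω| ≤ C := fun n ω =>
    StronglyMeasurable.norm_approxBounded_le W.stronglyMeasurable hC n ω
  have hslim : ∀ᵐ ω ∂μ, Tendsto (fun n => s n ω) atTop (𝓝 (W ω)) :=
    StronglyMeasurable.tendsto_approxBounded_ae W.stronglyMeasurable hW
  have hmk : ∀ᵐ ω ∂μ, ∀ n, AEEqFun.mk (s n) (s n).aestronglyMeasurable ω = s n ω :=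
    ae_all_iff.2 fun n => AEEqFun.coeFn_mk _ _
  have h1 : Tendsto (fun n => F (AEEqFun.mk (s n) (s n).aestronglyMeasurable)) atTop
      (𝓝 (F W)) := by
    refine tendsto_of_dominated hF (B := fun _ => C + C) (fun K => ?_) (fun n => ?_) ?_
    · simp [orliczModular]
    · filter_upwards [hmk, hW] with ω h1 h2
      rw [h1, abs_of_nonneg (add_nonneg hC hC)]
      exact (abs_sub _ _).trans (add_le_add (hs n ω) h2)
    · filter_upwards [hmk, hslim] with ω h1 h2
      simpa only [h1] using h2
  have h2 : Tendsto (fun n => ∫ ω, s n ω * Y ω ∂μ) atTop (𝓝 (∫ ω, W ω * Y ω ∂μ)) := by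
    refine tendsto_integral_of_dominated_convergence (fun ω => C * ‖Y ω‖)
      (fun n => (hint (s n)).aestronglyMeasurable) (hY.norm.const_mul C) (fun n => ?_) ?_
    · refine Eventually.of_forall fun ω => ?_
      rw [norm_mul]
      gcongr
      exact hs n ω
    · filter_upwards [hslim] with ω hω using hω.mul_const _
  simp only [hsimple] at h1
  exact tendsto_nhds_unique h1 h2

theorem abs_le_mul_one_add_modular
    (hF : ∀ W : Ω →ₘ[μ] ℝ, orliczModular Φ μ W ≤ 1 → |F W| ≤ M) {W : Ω →ₘ[μ] ℝ}
    (hW : orliczModular Φ μ W < ⊤) : |F W| ≤ M * (1 + (orliczModular Φ μ W).toReal) := by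
  set D := (orliczModular Φ μ W).toReal
  have hD : 0 ≤ D := ENNReal.toReal_nonneg
  have hD1 : 0 < 1 + D := by linarith
  have h1 : orliczModular Φ μ ((1 + D)⁻¹ • W : Ω →ₘ[μ] ℝ) ≤ 1 := by
    rw [orliczModular_congr (AEEqFun.coeFn_smul _ W)]
    refine (orliczModular_mul_le (by positivity) (inv_le_one_of_one_le₀ (by linarith)) _).trans ?_
    rw [← ENNReal.ofReal_toReal hW.ne, ← ENNReal.ofReal_mul (by positivity)]
    refine ENNReal.ofReal_le_one.2 ?_
    rw [inv_mul_le_iff₀ hD1]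
    change D ≤ _
    linarith
  have h2 := hF _ h1
  rw [map_smul, smul_eq_mul, abs_mul, abs_of_pos (inv_pos.2 hD1), inv_mul_le_iff₀ hD1] at h2
  rwa [mul_comm] at h2

/-- Running maximizers of `t s - Φ t` over an enumeration of a dense set of `t`. -/
noncomputable def youngMaximizer (Φ : OrliczFunction) (s : ℝ≥0) : ℕ → ℝ≥0
  | 0 => 0
  | n + 1 => by
      classical exact
        if (youngMaximizer Φ s n : ℝ) * s - Φ (youngMaximizer Φ s n) <
          (TopologicalSpace.denseSeq ℝ≥0 n : ℝ) * s - Φ (TopologicalSpace.denseSeq ℝ≥0 n)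
        then TopologicalSpace.denseSeq ℝ≥0 n else youngMaximizer Φ s n

/-- The value of `t s - Φ t` at the running maximizer. -/
noncomputable def youngMax (Φ : OrliczFunction) (s : ℝ≥0) (n : ℕ) : ℝ :=
  (youngMaximizer Φ s n : ℝ) * s - Φ (youngMaximizer Φ s n)

theorem measurable_youngMaximizer (n : ℕ) : Measurable fun s => youngMaximizer Φ s n := by
  induction n with
  | zero => exact measurable_const
  | succ n ih =>
    refine Measurable.ite (measurableSet_lt ?_ ?_) measurable_const ih
    · exact (ih.coe_nnreal_real.mul measurable_coe_nnreal_real).sub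
        (Φ.measurable.comp ih).coe_nnreal_real
    · exact (measurable_coe_nnreal_real.const_mul _).sub measurable_const

/-- Only finitely many values occur at stage `n`. The test functions built from them are therefore
bounded, where `F` is already known to be an integral. -/
theorem exists_youngMaximizer_le (n : ℕ) : ∃ C : ℝ≥0, ∀ s, youngMaximizer Φ s n ≤ C := by
  induction n with
  | zero => exact ⟨0, fun s => le_rfl⟩
  | succ n ih =>
    obtain ⟨C, hC⟩ := ih
    refine ⟨max C (TopologicalSpace.denseSeq ℝ≥0 n), fun s => ?_⟩
    rw [youngMaximizer]
    split_ifs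
    · exact le_max_right _ _
    · exact (hC s).trans (le_max_left _ _)

theorem youngMax_succ (s : ℝ≥0) (n : ℕ) : youngMax Φ s (n + 1) = max (youngMax Φ s n)
    ((TopologicalSpace.denseSeq ℝ≥0 n : ℝ) * s - Φ (TopologicalSpace.denseSeq ℝ≥0 n)) := by
  rw [youngMax, youngMaximizer]
  split_ifs with h
  · exact (max_eq_right h.le).symm
  · exact (max_eq_left (not_lt.1 h)).symm

theorem monotone_youngMax (s : ℝ≥0) : Monotone (youngMax Φ s) :=
  monotone_nat_of_le_succ fun n => by rw [youngMax_succ]; exact le_max_left _ _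

theorem youngMax_nonneg (s : ℝ≥0) (n : ℕ) : 0 ≤ youngMax Φ s n := by
  have h : youngMax Φ s 0 = 0 := by simp [youngMax, youngMaximizer, Φ.map_zero]
  rw [← h]
  exact monotone_youngMax s (Nat.zero_le n)

theorem conjugate_le_iSup_youngMax (h : Φ.IsConjugate Ψ) (s : ℝ≥0) :
    (Ψ s : ℝ≥0∞) ≤ ⨆ n, ENNReal.ofReal (youngMax Φ s n) := by
  rcases eq_or_ne (⨆ n, ENNReal.ofReal (youngMax Φ s n)) ⊤ with htop | htop
  · rw [htop]; exact le_top
  lift (⨆ n, ENNReal.ofReal (youngMax Φ s n)) to ℝ≥0 using htop with r hr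
  have hle : ∀ n, youngMax Φ s n ≤ r := fun n => by
    have h1 : ENNReal.ofReal (youngMax Φ s n) ≤ r := by
      rw [hr]; exact le_iSup (fun n => ENNReal.ofReal (youngMax Φ s n)) n
    rw [← ENNReal.ofReal_coe_nnreal] at h1
    exact (ENNReal.ofReal_le_ofReal_iff r.coe_nonneg).1 h1
  rw [ENNReal.coe_le_coe, ← NNReal.coe_le_coe]
  refine (h s).2 ?_
  rintro _ ⟨t, rfl⟩
  by_contra hcon
  simp only [not_le] at hcon
  have hlt : r + Φ t < t * s := by
    rw [← NNReal.coe_lt_coe]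
    push_cast
    linarith
  have hs : 0 < s := by
    rcases eq_or_ne s 0 with rfl | h0
    · simp at hlt
    · exact pos_iff_ne_zero.2 h0
  -- Taking `q` slightly below `t` keeps `q s > r + Φ t`, and `Φ q ≤ Φ t` by monotonicity, so
  -- continuity of `Φ` is not needed.
  obtain ⟨q, ⟨k, rfl⟩, hq1, hq2⟩ := (TopologicalSpace.denseRange_denseSeq ℝ≥0).exists_between
    ((div_lt_iff₀ hs).2 hlt)
  rw [div_lt_iff₀ hs] at hq1
  have h1 := (le_max_right _ _).trans ((youngMax_succ s k).symm.le.trans (hle (k + 1)))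
  have h2 : Φ (TopologicalSpace.denseSeq ℝ≥0 k) ≤ Φ t := Φ.monotone hq2.le
  rw [← NNReal.coe_le_coe] at h2
  rw [← NNReal.coe_lt_coe] at hq1
  push_cast at hq1
  linarith

/-- Test `F` on `w sign(Y)`, where `w` is the running maximizer of `t s - Φ t` at `s = |Y| / M`. The
bound `E[w |Y|] ≤ M (1 + E[Φ(w)])` says that `E[w s - Φ(w)] ≤ 1`; monotone convergence over the
stages yields `E[Ψ(s)] ≤ 1`. -/
theorem lintegral_conjugate_le_one [IsProbabilityMeasure μ] (h : Φ.IsConjugate Ψ) (hM : 0 < M)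
    (hF : ∀ W : Ω →ₘ[μ] ℝ, orliczModular Φ μ W ≤ 1 → |F W| ≤ M) {Y : Ω → ℝ} (hYm : Measurable Y)
    (hY : Integrable Y μ)
    (hYF : ∀ (W : Ω →ₘ[μ] ℝ) (C : ℝ), (∀ᵐ ω ∂μ, |W ω| ≤ C) → F W = ∫ ω, W ω * Y ω ∂μ) :
    orliczModular Ψ μ (fun ω => M⁻¹ * Y ω) ≤ 1 := by
  let s : Ω → ℝ≥0 := fun ω => ‖M⁻¹ * Y ω‖₊
  have hs : Measurable s := (hYm.const_mul _).nnnorm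
  have hsY : ∀ ω, (s ω : ℝ) = M⁻¹ * |Y ω| := fun ω => by
    simp only [s, coe_nnnorm, Real.norm_eq_abs, abs_mul, abs_of_pos (inv_pos.2 hM)]
  have hmeas : ∀ n, Measurable fun ω => youngMax Φ (s ω) n := fun n => by
    have := (measurable_youngMaximizer (Φ := Φ) n).comp hs
    exact (this.coe_nnreal_real.mul hs.coe_nnreal_real).sub
      (Φ.measurable.comp this).coe_nnreal_real
  have key : ∀ n, ∫⁻ ω, ENNReal.ofReal (youngMax Φ (s ω) n) ∂μ ≤ 1 := by
    intro n
    let w : Ω → ℝ≥0 := fun ω => youngMaximizer Φ (s ω) n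
    have hw : Measurable w := (measurable_youngMaximizer n).comp hs
    obtain ⟨C, hC⟩ := exists_youngMaximizer_le (Φ := Φ) n
    have hwC : ∀ ω, w ω ≤ C := fun ω => hC _
    let v : Ω → ℝ := fun ω => w ω * SignType.sign (Y ω)
    have hsign : Measurable fun ω => ((SignType.sign (Y ω) : SignType) : ℝ) := by
      have : (fun x : ℝ => ((SignType.sign x : SignType) : ℝ)) =
          fun x => if 0 < x then 1 else if x < 0 then -1 else 0 := by
        funext x
        rw [sign_apply]
        split_ifs <;> simp
      have hm : Measurable fun x : ℝ => ((SignType.sign x : SignType) : ℝ) := by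
        rw [this]
        exact Measurable.ite measurableSet_Ioi measurable_const
          (Measurable.ite measurableSet_Iio measurable_const measurable_const)
      exact hm.comp hYm
    have hv : Measurable v := hw.coe_nnreal_real.mul hsign
    have hvw : ∀ ω, |v ω| ≤ w ω := fun ω => by
      simp only [v, abs_mul, NNReal.abs_eq]
      refine mul_le_of_le_one_right (w ω).coe_nonneg ?_
      rcases SignType.sign (Y ω) with _ | _ | _ <;> simp
    have hvY : ∀ ω, v ω * Y ω = w ω * |Y ω| := fun ω => by
      simp only [v]
      rw [mul_assoc, sign_mul_self]
    let V : Ω →ₘ[μ] ℝ := AEEqFun.mk v hv.aestronglyMeasurable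
    have hV : V =ᵐ[μ] v := AEEqFun.coeFn_mk _ _
    have hVw : ∀ᵐ ω ∂μ, |V ω| ≤ |(w ω : ℝ)| := by
      filter_upwards [hV] with ω hω
      rw [hω, NNReal.abs_eq]
      exact hvw ω
    have hVC : ∀ᵐ ω ∂μ, |V ω| ≤ C := by
      filter_upwards [hVw] with ω hω
      rw [NNReal.abs_eq] at hω
      exact hω.trans (by exact_mod_cast hwC ω)
    have hwmod : orliczModular Φ μ (fun ω => (w ω : ℝ)) ≤ Φ C :=
      orliczModular_le_of_bound (Eventually.of_forall fun ω => by
        rw [NNReal.abs_eq]; exact_mod_cast hwC ω)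
    have hwtop : orliczModular Φ μ (fun ω => (w ω : ℝ)) < ⊤ :=
      hwmod.trans_lt ENNReal.coe_lt_top
    have hΦint : Integrable (fun ω => (Φ (w ω) : ℝ)) μ :=
      Integrable.of_bound (Φ.measurable.comp hw).coe_nnreal_real.aestronglyMeasurable (Φ C)
        (Eventually.of_forall fun ω => by
          rw [NNReal.norm_eq]; exact_mod_cast Φ.monotone (hwC ω))
    have hΦeq : (orliczModular Φ μ (fun ω => (w ω : ℝ))).toReal = ∫ ω, (Φ (w ω) : ℝ) ∂μ := by
      rw [integral_eq_lintegral_of_nonneg_ae (Eventually.of_forall fun ω => NNReal.coe_nonneg _)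
        hΦint.aestronglyMeasurable]
      simp [orliczModular]
    have hwY : Integrable (fun ω => (w ω : ℝ) * |Y ω|) μ :=
      hY.abs.bdd_mul (c := (C : ℝ)) hw.coe_nnreal_real.aestronglyMeasurable
        (Eventually.of_forall fun ω => by rw [NNReal.norm_eq]; exact_mod_cast hwC ω)
    have hmain : ∫ ω, (w ω : ℝ) * |Y ω| ∂μ ≤ M * (1 + ∫ ω, (Φ (w ω) : ℝ) ∂μ) := by
      have h1 : F V = ∫ ω, (w ω : ℝ) * |Y ω| ∂μ := by
        rw [hYF V C hVC]
        refine integral_congr_ae ?_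
        filter_upwards [hV] with ω hω
        rw [hω, hvY]
      have h2 := orliczModular_mono (Φ := Φ) hVw
      rw [← h1, ← hΦeq]
      refine (le_abs_self _).trans
        ((abs_le_mul_one_add_modular hF (h2.trans_lt hwtop)).trans ?_)
      gcongr
      exact hwtop.ne
    have hint : Integrable (fun ω => youngMax Φ (s ω) n) μ := by
      have : (fun ω => youngMax Φ (s ω) n) =
          fun ω => M⁻¹ * ((w ω : ℝ) * |Y ω|) - (Φ (w ω) : ℝ) := by
        funext ω
        rw [youngMax, hsY]
        ring
      rw [this]
      exact (hwY.const_mul _).sub hΦint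
    rw [← ofReal_integral_eq_lintegral_ofReal hint
      (Eventually.of_forall fun ω => youngMax_nonneg _ _)]
    refine ENNReal.ofReal_le_one.2 ?_
    calc ∫ ω, youngMax Φ (s ω) n ∂μ
        = ∫ ω, (M⁻¹ * ((w ω : ℝ) * |Y ω|) - (Φ (w ω) : ℝ)) ∂μ := by
          refine integral_congr_ae (Eventually.of_forall fun ω => ?_)
          simp only [youngMax, hsY, w]
          ring
      _ = M⁻¹ * ∫ ω, (w ω : ℝ) * |Y ω| ∂μ - ∫ ω, (Φ (w ω) : ℝ) ∂μ := by
          rw [integral_sub (hwY.const_mul _) hΦint, integral_const_mul]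
      _ ≤ M⁻¹ * (M * (1 + ∫ ω, (Φ (w ω) : ℝ) ∂μ)) - ∫ ω, (Φ (w ω) : ℝ) ∂μ := by
          gcongr
      _ = 1 := by
          rw [inv_mul_cancel_left₀ hM.ne']
          ring
  calc orliczModular Ψ μ (fun ω => M⁻¹ * Y ω)
      ≤ ∫⁻ ω, ⨆ n, ENNReal.ofReal (youngMax Φ (s ω) n) ∂μ :=
        lintegral_mono fun ω => conjugate_le_iSup_youngMax h (s ω)
    _ = ⨆ n, ∫⁻ ω, ENNReal.ofReal (youngMax Φ (s ω) n) ∂μ :=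
        lintegral_iSup (fun n => (hmeas n).ennreal_ofReal) fun m n hmn ω =>
          ENNReal.ofReal_le_ofReal (monotone_youngMax _ hmn)
    _ ≤ 1 := iSup_le key

theorem exists_eq_orliczPairing [IsProbabilityMeasure μ] (h : Φ.IsConjugate Ψ)
    (hΔ : Φ.DeltaTwo) (f : orliczSpace Φ μ →ₗ[ℝ] ℝ)
    (hf : ∀ W : orliczSpace Φ μ, orliczModular Φ μ (W : Ω →ₘ[μ] ℝ) ≤ 1 → |f W| ≤ M) :
    ∃ Y : orliczSpace Ψ μ, ∀ X, f X = orliczPairing h μ X Y := by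
  -- A purely algebraic extension to all random variables avoids carrying membership proofs. The
  -- bound survives because modular at most `1` already implies membership in `L^Φ`.
  obtain ⟨F, hFf⟩ := f.exists_extend
  have hFf' : ∀ X : orliczSpace Φ μ, F X = f X := fun X => LinearMap.congr_fun hFf X
  have hF : ∀ W : Ω →ₘ[μ] ℝ, orliczModular Φ μ W ≤ 1 → |F W| ≤ |M| + 1 := by
    intro W hW
    have hmem : W ∈ orliczSpace Φ μ := mem_orliczSpace_of_modular one_pos (by
      simpa only [one_mul] using hW.trans_lt ENNReal.one_lt_top)
    have := hf ⟨W, hmem⟩ hW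
    rw [← hFf'] at this
    linarith [le_abs_self M]
  obtain ⟨Y₀, hY₀, hYF₀⟩ := exists_density hF
  let Y : Ω →ₘ[μ] ℝ := AEEqFun.mk Y₀ hY₀.aestronglyMeasurable
  have hYY₀ : Y =ᵐ[μ] Y₀ := AEEqFun.coeFn_mk _ _
  have hY : Integrable Y μ := hY₀.congr hYY₀.symm
  have hYF : ∀ (W : Ω →ₘ[μ] ℝ) (C : ℝ), (∀ᵐ ω ∂μ, |W ω| ≤ C) → F W = ∫ ω, W ω * Y ω ∂μ :=
    fun W C hW => by
      rw [eq_integral_of_bound hF hY₀ hYF₀ hW]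
      refine integral_congr_ae ?_
      filter_upwards [hYY₀] with ω hω
      rw [hω]
  have hM : 0 < |M| + 1 := by positivity
  have hYmem : Y ∈ orliczSpace Ψ μ := mem_orliczSpace_of_modular (inv_pos.2 hM)
    ((lintegral_conjugate_le_one h hM hF Y.measurable hY hYF).trans_lt ENNReal.one_lt_top)
  refine ⟨⟨Y, hYmem⟩, fun X => ?_⟩
  rw [← hFf', orliczPairing_apply]
  have hT : ∀ n : ℕ, MeasurableSet {ω | |(X : Ω →ₘ[μ] ℝ) ω| ≤ n} := fun n =>
    measurableSet_le (X : Ω →ₘ[μ] ℝ).measurable.abs measurable_const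
  let w : ℕ → Ω → ℝ := fun n => {ω | |(X : Ω →ₘ[μ] ℝ) ω| ≤ n}.indicator (X : Ω →ₘ[μ] ℝ)
  have hwm : ∀ n, AEStronglyMeasurable (w n) μ := fun n =>
    ((X : Ω →ₘ[μ] ℝ).stronglyMeasurable.indicator (hT n)).aestronglyMeasurable
  have hwle : ∀ n ω, |w n ω| ≤ |(X : Ω →ₘ[μ] ℝ) ω| := fun n ω =>
    norm_indicator_le_norm_self (X : Ω →ₘ[μ] ℝ) ω
  have hwn : ∀ n ω, |w n ω| ≤ n := fun n ω => by
    by_cases hω : |(X : Ω →ₘ[μ] ℝ) ω| ≤ n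
    · exact (hwle n ω).trans hω
    · simp [w, Set.indicator_of_notMem (show ω ∉ {ω | |(X : Ω →ₘ[μ] ℝ) ω| ≤ n} from hω)]
  have hwlim : ∀ ω, Tendsto (fun n => w n ω) atTop (𝓝 ((X : Ω →ₘ[μ] ℝ) ω)) := fun ω => by
    obtain ⟨N, hN⟩ := exists_nat_ge |(X : Ω →ₘ[μ] ℝ) ω|
    refine tendsto_const_nhds.congr' ?_
    filter_upwards [eventually_ge_atTop N] with n hn
    have hmem : ω ∈ {ω | |(X : Ω →ₘ[μ] ℝ) ω| ≤ n} :=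
      show |(X : Ω →ₘ[μ] ℝ) ω| ≤ n from hN.trans (Nat.cast_le.2 hn)
    exact (Set.indicator_of_mem hmem _).symm
  have hmk : ∀ᵐ ω ∂μ, ∀ n, AEEqFun.mk (w n) (hwm n) ω = w n ω :=
    ae_all_iff.2 fun n => AEEqFun.coeFn_mk _ _
  have h1 : Tendsto (fun n => F (AEEqFun.mk (w n) (hwm n))) atTop (𝓝 (F X)) := by
    -- The truncations `w n` differ from `X` by at most `2|X|`, all of whose multiples have finite
    -- modular by Δ₂.
    refine tendsto_of_dominated hF (B := fun ω => 2 * (X : Ω →ₘ[μ] ℝ) ω) (fun K => ?_)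
      (fun n => ?_) ?_
    · simpa only [mul_assoc] using hΔ.modular_lt_top X.2 (K * 2)
    · filter_upwards [hmk] with ω hω
      rw [hω, abs_mul, abs_two, two_mul]
      exact (abs_sub _ _).trans (add_le_add_left (hwle n ω) _)
    · filter_upwards [hmk] with ω hω
      simpa only [hω] using hwlim ω
  have h2 : Tendsto (fun n => ∫ ω, w n ω * Y ω ∂μ) atTop
      (𝓝 (∫ ω, (X : Ω →ₘ[μ] ℝ) ω * Y ω ∂μ)) := by
    refine tendsto_integral_of_dominated_convergence
      (fun ω => ‖(X : Ω →ₘ[μ] ℝ) ω * Y ω‖)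
      (fun n => (hwm n).mul Y.aestronglyMeasurable)
      (integrable_orlicz_mul h X ⟨Y, hYmem⟩).norm (fun n => ?_) ?_
    · refine Eventually.of_forall fun ω => ?_
      rw [norm_mul, norm_mul]
      gcongr
      exact hwle n ω
    · exact Eventually.of_forall fun ω => (hwlim ω).mul_const _
  have h3 : ∀ n, F (AEEqFun.mk (w n) (hwm n)) = ∫ ω, w n ω * Y ω ∂μ := fun n => by
    rw [hYF _ n (by filter_upwards [hmk] with ω hω; rw [hω]; exact hwn n ω)]
    refine integral_congr_ae ?_
    filter_upwards [hmk] with ω hω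
    rw [hω]
  simp only [h3] at h1
  exact tendsto_nhds_unique h1 h2

end Representation

/-- With `p` as the norm, the open unit ball around `x` misses `C`. Geometric Hahn–Banach separates
them, and the operator norm serves as `M`. -/
theorem Seminorm.exists_separating {E : Type*} [AddCommGroup E] [Module ℝ E] (p : Seminorm ℝ E)
    {C : Set E} (hC : Convex ℝ C) {x : E} (h : ∀ c ∈ C, 1 ≤ p (c - x)) :
    ∃ (f : E →ₗ[ℝ] ℝ) (M u : ℝ), (∀ v, |f v| ≤ M * p v) ∧ f x < u ∧ ∀ c ∈ C, u ≤ f c := by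
  let : SeminormedAddCommGroup E := p.toAddGroupSeminorm.toSeminormedAddCommGroup
  let : NormedSpace ℝ E := { norm_smul_le := fun a b => (map_smul_eq_mul p a b).le }
  have hdisj : Disjoint (Metric.ball x 1) C := by
    rw [Set.disjoint_left]
    intro c hc hcC
    rw [Metric.mem_ball, dist_eq_norm] at hc
    exact (h c hcC).not_gt hc
  obtain ⟨f, u, hf, hu⟩ := geometric_hahn_banach_open (_root_.convex_ball x 1) Metric.isOpen_ball hC hdisj
  exact ⟨f, ‖f‖, u, f.le_opNorm, hf x (Metric.mem_ball_self one_pos), hu⟩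

/-! ### Sufficiency: from weak closure to order closure -/

section OrderClosure

variable {Ω : Type*} [MeasurableSpace Ω] {μ : Measure Ω} {Φ Ψ : OrliczFunction}

theorem orliczModular_combo_le {X Y : Ω → ℝ} (hX : AEMeasurable X μ) {p q : ℝ} (hp : 0 ≤ p)
    (hq : 0 ≤ q) (hpq : p + q = 1) :
    orliczModular Φ μ (fun ω => p * X ω + q * Y ω) ≤
      ENNReal.ofReal p * orliczModular Φ μ X + ENNReal.ofReal q * orliczModular Φ μ Y := by
  lift p to ℝ≥0 using hp
  lift q to ℝ≥0 using hq
  have hpq' : p + q = 1 := by exact_mod_cast hpq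
  rw [ENNReal.ofReal_coe_nnreal, ENNReal.ofReal_coe_nnreal, orliczModular, orliczModular,
    orliczModular, ← lintegral_const_mul' _ _ ENNReal.coe_ne_top,
    ← lintegral_const_mul' _ _ ENNReal.coe_ne_top,
    ← lintegral_add_left' ((aemeasurable_orliczModular hX).const_mul _)]
  refine lintegral_mono fun ω => ?_
  rw [← ENNReal.coe_mul, ← ENNReal.coe_mul, ← ENNReal.coe_add, ENNReal.coe_le_coe]
  have h1 : ‖(p : ℝ) * X ω + q * Y ω‖₊ ≤ p • ‖X ω‖₊ + q • ‖Y ω‖₊ := by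
    refine (nnnorm_add_le _ _).trans (le_of_eq ?_)
    simp [nnnorm_mul]
  exact (Φ.monotone h1).trans
    (Φ.convexOn.2 (Set.mem_univ _) (Set.mem_univ _) zero_le zero_le hpq')

/-- The set of all `W` with `E[Φ(K |W|)] ≤ 1`. -/
def modularBall (Φ : OrliczFunction) (μ : Measure Ω) (K : ℝ) : Set (orliczSpace Φ μ) :=
  {W | orliczModular Φ μ (fun ω => K * (W : Ω →ₘ[μ] ℝ) ω) ≤ 1}

theorem mem_modularBall_of_abs_le {K L a : ℝ} (h : |K * a| ≤ |L|) {W : orliczSpace Φ μ}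
    (hW : W ∈ modularBall Φ μ L) : a • W ∈ modularBall Φ μ K := by
  refine le_trans (orliczModular_mono ?_) hW
  filter_upwards [AEEqFun.coeFn_smul a (W : Ω →ₘ[μ] ℝ)] with ω hω
  rw [Submodule.coe_smul, hω, Pi.smul_apply, smul_eq_mul, ← mul_assoc, abs_mul, abs_mul L]
  gcongr

theorem convex_modularBall (K : ℝ) : Convex ℝ (modularBall Φ μ K) := by
  intro X hX Y hY p q hp hq hpq
  have hcongr : orliczModular Φ μ
      (fun ω => K * ((p • X + q • Y : orliczSpace Φ μ) : Ω →ₘ[μ] ℝ) ω) =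
      orliczModular Φ μ (fun ω => p * (K * (X : Ω →ₘ[μ] ℝ) ω) +
        q * (K * (Y : Ω →ₘ[μ] ℝ) ω)) := by
    refine orliczModular_congr ?_
    filter_upwards [AEEqFun.coeFn_add (p • (X : Ω →ₘ[μ] ℝ)) (q • (Y : Ω →ₘ[μ] ℝ)),
      AEEqFun.coeFn_smul p (X : Ω →ₘ[μ] ℝ), AEEqFun.coeFn_smul q (Y : Ω →ₘ[μ] ℝ)] with ω h1 h2 h3
    rw [Submodule.coe_add, Submodule.coe_smul, Submodule.coe_smul, h1, Pi.add_apply, h2, h3,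
      Pi.smul_apply, Pi.smul_apply, smul_eq_mul, smul_eq_mul]
    ring
  rw [modularBall, Set.mem_ofPred_eq, hcongr]
  calc _ ≤ _ := orliczModular_combo_le ((X : Ω →ₘ[μ] ℝ).aemeasurable.const_mul K) hp hq hpq
    _ ≤ ENNReal.ofReal p * 1 + ENNReal.ofReal q * 1 := by gcongr <;> assumption
    _ = 1 := by rw [mul_one, mul_one, ← ENNReal.ofReal_add hp hq, hpq, ENNReal.ofReal_one]

theorem balanced_modularBall (K : ℝ) : Balanced ℝ (modularBall Φ μ K) := by
  rw [balanced_iff_smul_mem]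
  intro a ha W hW
  refine mem_modularBall_of_abs_le ?_ hW
  rw [abs_mul]
  exact mul_le_of_le_one_right (abs_nonneg _) ha

theorem absorbent_modularBall {K : ℝ} (hK : 0 < K) : Absorbent ℝ (modularBall Φ μ K) := by
  intro W
  obtain ⟨c, hc, hm⟩ := exists_modular_le_one W.2
  rw [absorbs_iff_norm]
  refine ⟨K / c, fun a ha => Set.singleton_subset_iff.2 ?_⟩
  have ha0 : 0 < |a| := lt_of_lt_of_le (by positivity) ha
  rw [Set.mem_smul_set_iff_inv_smul_mem₀ (abs_pos.1 ha0)]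
  refine mem_modularBall_of_abs_le ?_ hm
  rw [abs_mul, abs_inv, abs_of_pos hK, abs_of_pos hc, ← div_eq_mul_inv, div_le_iff₀ ha0]
  rwa [Real.norm_eq_abs, div_le_iff₀' hc] at ha

/-- The seminorm is the gauge of the ball. The second bound turns `p`-continuity of a functional
into boundedness on the modular unit ball, the hypothesis of the representation theorem. -/
theorem exists_seminorm_modularBall {K : ℝ} (hK : 0 < K) :
    ∃ p : Seminorm ℝ (orliczSpace Φ μ), (∀ W, p W < 1 → W ∈ modularBall Φ μ K) ∧
      ∀ W : orliczSpace Φ μ, orliczModular Φ μ (W : Ω →ₘ[μ] ℝ) ≤ 1 → p W ≤ K := by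
  have habs : Absorbent ℝ (modularBall Φ μ K) := absorbent_modularBall hK
  refine ⟨gaugeSeminorm (balanced_modularBall K) (convex_modularBall K) habs, fun W hW => ?_,
    fun W hW => ?_⟩
  · exact setOfPred_gauge_lt_one_subset_self (convex_modularBall K) habs.zero_mem habs hW
  · have hW1 : W ∈ modularBall Φ μ 1 := by
      simpa only [modularBall, Set.mem_ofPred_eq, one_mul] using hW
    have hW2 : K⁻¹ • W ∈ modularBall Φ μ K :=
      mem_modularBall_of_abs_le (by rw [mul_inv_cancel₀ hK.ne']) hW1
    exact gauge_le_of_mem hK.le ((Set.mem_smul_set_iff_inv_smul_mem₀ hK.ne' _ _).2 hW2)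

theorem weakClosure_subset_halfSpace (h : Φ.IsConjugate Ψ) (Y : orliczSpace Ψ μ) {u : ℝ}
    {C : Set (orliczSpace Φ μ)} (hC : ∀ Z ∈ C, u ≤ orliczPairing h μ Z Y) :
    weakClosure h C ⊆ {Z | u ≤ orliczPairing h μ Z Y} := by
  have hclosed := @IsClosed.preimage _ _ (WeakBilin.instTopologicalSpace (orliczPairing h μ)) _ _
    (continuous_orliczPairing h Y) _ (isClosed_Ici (a := u))
  exact @closure_minimal _ (WeakBilin.instTopologicalSpace (orliczPairing h μ)) _ _ hC hclosed

/-- Mazur's argument: otherwise a `p`-bounded functional separates `X` from `C`. Under Δ₂ it is a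
pairing with some `Y` in `L^Ψ`, so it defines a weakly closed half-space containing `C` but not `X`.
-/
theorem exists_sub_mem_modularBall [IsProbabilityMeasure μ] (h : Φ.IsConjugate Ψ)
    (hΔ : Φ.DeltaTwo) {C : Set (orliczSpace Φ μ)} (hC : Convex ℝ C) {X : orliczSpace Φ μ}
    (hX : X ∈ weakClosure h C) {K : ℝ} (hK : 0 < K) : ∃ Z ∈ C, Z - X ∈ modularBall Φ μ K := by
  by_contra! hcon
  obtain ⟨p, hp1, hp2⟩ := exists_seminorm_modularBall (Φ := Φ) (μ := μ) hK
  have hp : ∀ c ∈ C, 1 ≤ p (c - X) := fun c hc => by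
    by_contra hlt
    exact hcon c hc (hp1 _ (not_le.1 hlt))
  obtain ⟨f, M, u, hfM, hfX, hfC⟩ := p.exists_separating hC hp
  have hf : ∀ W : orliczSpace Φ μ, orliczModular Φ μ (W : Ω →ₘ[μ] ℝ) ≤ 1 → |f W| ≤ |M| * K := by
    intro W hW
    have hpW : p W ≤ K := hp2 W hW
    calc |f W| ≤ M * p W := hfM W
      _ ≤ |M| * p W := by gcongr; exact le_abs_self M
      _ ≤ |M| * K := by gcongr
  obtain ⟨Y, hY⟩ := exists_eq_orliczPairing h hΔ f hf
  have hsub : weakClosure h C ⊆ {Z | u ≤ orliczPairing h μ Z Y} :=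
    weakClosure_subset_halfSpace h Y fun Z hZ => by rw [← hY]; exact hfC Z hZ
  have := hsub hX
  rw [Set.mem_ofPred_eq, ← hY] at this
  linarith

/-- Of the factor `4^n`, one `2^n` makes the modulars of `2^n D n` summable by convexity. The other
gives decay: `∑ Φ(2^n |D n|)` is almost surely finite and `Φ` tends to infinity, so `2^n |D n|` is
bounded in `n` and `D n → 0`. The same sum controls `G = sup |D n|`, and `|X| + G` is the order
bound. -/
theorem mem_orderClosure_of_forall_modularBall (hΦ : ∀ t : ℝ≥0, 0 < t → 0 < Φ t)
    {C : Set (orliczSpace Φ μ)} {X : orliczSpace Φ μ}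
    (hX : ∀ K : ℝ, 0 < K → ∃ Z ∈ C, Z - X ∈ modularBall Φ μ K) : X ∈ orderClosure C := by
  choose Z hZC hZ using fun n : ℕ => hX (4 ^ n) (by positivity)
  let D : ℕ → Ω → ℝ := fun n ω => ((Z n - X : orliczSpace Φ μ) : Ω →ₘ[μ] ℝ) ω
  have hDm : ∀ n, Measurable (D n) := fun n => AEEqFun.measurable _
  have hDZ : ∀ᵐ ω ∂μ, ∀ n, D n ω = (Z n : Ω →ₘ[μ] ℝ) ω - (X : Ω →ₘ[μ] ℝ) ω :=
    ae_all_iff.2 fun n => AEEqFun.coeFn_sub (Z n : Ω →ₘ[μ] ℝ) X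
  have hmod : ∀ n, orliczModular Φ μ (fun ω => 2 ^ n * D n ω) ≤ ((2⁻¹ ^ n : ℝ≥0) : ℝ≥0∞) := by
    intro n
    have h1 := orliczModular_mul_le (Φ := Φ) (μ := μ) (c := 2⁻¹ ^ n) (by positivity)
      (pow_le_one₀ (by norm_num) (by norm_num)) (fun ω => 4 ^ n * D n ω)
    have h2 : (fun ω => (2⁻¹ : ℝ) ^ n * (4 ^ n * D n ω)) = fun ω => 2 ^ n * D n ω := by
      funext ω
      rw [← mul_assoc, ← mul_pow]
      norm_num
    rw [h2] at h1
    refine (h1.trans (mul_le_of_le_one_right' (hZ n))).trans (le_of_eq ?_)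
    rw [ENNReal.ofReal, ENNReal.coe_inj, ← NNReal.coe_inj, Real.coe_toNNReal _ (by positivity)]
    norm_num
  let S : Ω → ℝ≥0∞ := fun ω => ∑' n, (Φ ‖2 ^ n * D n ω‖₊ : ℝ≥0∞)
  have hSm : Measurable S := Measurable.tsum fun n =>
    (Φ.measurable.comp ((hDm n).const_mul _).nnnorm).coe_nnreal_ennreal
  have hSint : ∫⁻ ω, S ω ∂μ ≠ ⊤ := by
    rw [lintegral_tsum fun n => aemeasurable_orliczModular ((hDm n).const_mul _).aemeasurable]
    refine ne_top_of_le_ne_top ?_ (ENNReal.tsum_le_tsum hmod)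
    rw [ENNReal.tsum_coe_ne_top_iff_summable]
    exact NNReal.summable_geometric (inv_lt_one_of_one_lt₀ one_lt_two)
  have hbound : ∀ᵐ ω ∂μ, ∃ T : ℝ≥0, ∀ n, 2 ^ n * |D n ω| ≤ T := by
    filter_upwards [ae_lt_top hSm hSint] with ω hω
    obtain ⟨T, hT⟩ := ((OrliczFunction.tendsto_atTop hΦ).eventually_gt_atTop
      (S ω).toNNReal).exists
    refine ⟨T, fun n => ?_⟩
    by_contra hlt
    rw [not_le] at hlt
    have h1 : T ≤ ‖2 ^ n * D n ω‖₊ := by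
      rw [← NNReal.coe_le_coe, coe_nnnorm, Real.norm_eq_abs, abs_mul, abs_of_pos (by positivity)]
      exact hlt.le
    have h2 : (Φ T : ℝ≥0∞) ≤ S ω := (ENNReal.coe_le_coe.2 (Φ.monotone h1)).trans
      (ENNReal.le_tsum (f := fun n => (Φ ‖2 ^ n * D n ω‖₊ : ℝ≥0∞)) n)
    rw [← ENNReal.coe_toNNReal hω.ne, ENNReal.coe_le_coe] at h2
    exact hT.not_ge h2
  let G : Ω → ℝ≥0∞ := fun ω => ⨆ n, ‖D n ω‖ₑ
  have hG : Measurable G := Measurable.iSup fun n => (hDm n).enorm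
  have hGtop : ∀ᵐ ω ∂μ, G ω ≠ ⊤ := by
    filter_upwards [hbound] with ω ⟨T, hT⟩
    refine ne_top_of_le_ne_top ENNReal.coe_ne_top (iSup_le fun n => ?_ : G ω ≤ (T : ℝ≥0∞))
    rw [enorm_eq_nnnorm, ENNReal.coe_le_coe, ← NNReal.coe_le_coe, coe_nnnorm, Real.norm_eq_abs]
    exact (le_mul_of_one_le_left (abs_nonneg _) (one_le_pow₀ one_le_two)).trans (hT n)
  have hDG : ∀ᵐ ω ∂μ, ∀ n, |D n ω| ≤ (G ω).toReal := by
    filter_upwards [hGtop] with ω hω n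
    have h1 : ‖D n ω‖ₑ ≤ G ω := le_iSup (fun n => ‖D n ω‖ₑ) n
    simpa using ENNReal.toReal_mono hω h1
  have hGm : AEStronglyMeasurable (fun ω => (G ω).toReal) μ :=
    hG.ennreal_toReal.aestronglyMeasurable
  have hGmod : orliczModular Φ μ (fun ω => 2⁻¹ * (G ω).toReal) ≤ ∫⁻ ω, S ω ∂μ := by
    refine lintegral_mono_ae ?_
    filter_upwards [hGtop] with ω hω
    rcases eq_or_ne (G ω) 0 with h0 | h0
    · simp [h0, Φ.map_zero]
    -- Halving `G` provides an index with `|D n| > G / 2` without showing that the supremum is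
    -- attained.
    · obtain ⟨n, hn⟩ := lt_iSup_iff.1 (ENNReal.half_lt_self h0 hω)
      refine le_trans (ENNReal.coe_le_coe.2 (Φ.monotone ?_))
        (ENNReal.le_tsum (f := fun n => (Φ ‖2 ^ n * D n ω‖₊ : ℝ≥0∞)) n)
      have h1 := ENNReal.toReal_mono enorm_ne_top hn.le
      rw [ENNReal.toReal_div, toReal_enorm, Real.norm_eq_abs] at h1
      rw [← NNReal.coe_le_coe, coe_nnnorm, coe_nnnorm, Real.norm_eq_abs, Real.norm_eq_abs,
        abs_of_nonneg (by positivity), abs_mul, abs_of_pos (by positivity : (0 : ℝ) < 2 ^ n),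
        inv_mul_eq_div]
      exact h1.trans (le_mul_of_one_le_left (abs_nonneg _) (one_le_pow₀ one_le_two))
  have hGmem : AEEqFun.mk _ hGm ∈ orliczSpace Φ μ :=
    mem_orliczSpace_of_modular (c := 2⁻¹) (by norm_num) (by
      rw [orliczModular_congr (Y := fun ω => 2⁻¹ * (G ω).toReal)]
      · exact hGmod.trans_lt (lt_top_iff_ne_top.2 hSint)
      · filter_upwards [AEEqFun.coeFn_mk _ hGm] with ω hω
        rw [hω])
  have habsm : AEStronglyMeasurable (fun ω => |(X : Ω →ₘ[μ] ℝ) ω|) μ :=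
    (X : Ω →ₘ[μ] ℝ).measurable.abs.aestronglyMeasurable
  have habsmem : AEEqFun.mk _ habsm ∈ orliczSpace Φ μ := mem_orliczSpace_of_le X.2 (by
    filter_upwards [AEEqFun.coeFn_mk _ habsm] with ω hω
    rw [hω, abs_abs])
  refine ⟨Z, hZC, ?_, ⟨AEEqFun.mk _ habsm, habsmem⟩ + ⟨AEEqFun.mk _ hGm, hGmem⟩, fun n => ?_⟩
  · filter_upwards [hbound, hDZ] with ω ⟨T, hT⟩ hω
    have hlim : Tendsto (fun n => D n ω) atTop (𝓝 0) := by
      have hgeo : Tendsto (fun n : ℕ => (T : ℝ) * 2⁻¹ ^ n) atTop (𝓝 0) := by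
        simpa using (tendsto_pow_atTop_nhds_zero_of_lt_one (r := (2⁻¹ : ℝ)) (by norm_num)
          (by norm_num)).const_mul (T : ℝ)
      refine squeeze_zero_norm (fun n => ?_) hgeo
      rw [inv_pow, ← div_eq_mul_inv, le_div_iff₀' (by positivity)]
      exact hT n
    simpa [hω] using hlim.add_const ((X : Ω →ₘ[μ] ℝ) ω)
  · filter_upwards [hDG, hDZ, AEEqFun.coeFn_mk _ hGm, AEEqFun.coeFn_mk _ habsm,
      AEEqFun.coeFn_add (AEEqFun.mk _ habsm) (AEEqFun.mk _ hGm)] with ω h1 h2 h3 h4 h5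
    rw [Submodule.coe_add, h5, Pi.add_apply, h3, h4]
    have h6 := h1 n
    rw [h2] at h6
    have h7 := abs_add_le ((X : Ω →ₘ[μ] ℝ) ω) ((Z n : Ω →ₘ[μ] ℝ) ω - (X : Ω →ₘ[μ] ℝ) ω)
    rw [add_sub_cancel] at h7
    linarith

end OrderClosure

theorem proposition3p3 {Ω : Type*} [MeasurableSpace Ω] (μ : Measure Ω) [IsProbabilityMeasure μ]
    (hμ : IsNonatomic μ) (Φ Ψ : OrliczFunction) (hΦΨ : Φ.IsConjugate Ψ)
    (hΦ_superlinear : Tendsto (fun t : ℝ≥0 => Φ t / t) atTop atTop)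
    (hΦ_pos : ∀ t : ℝ≥0, 0 < t → 0 < Φ t) :
    (∀ C : Set (orliczSpace Φ μ), Convex ℝ C → orderClosure C = weakClosure hΦΨ C) ↔
      Φ.DeltaTwo := by
  refine ⟨deltaTwo_of_orderClosure_eq_weakClosure hμ hΦ_pos hΦΨ, fun hΔ C hC => ?_⟩
  refine (orderClosure_subset_weakClosure hΦΨ C).antisymm fun X hX => ?_
  exact mem_orderClosure_of_forall_modularBall hΦ_pos fun K hK =>
    exists_sub_mem_modularBall hΦΨ hΔ hC hX hK
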